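/- Let $k$ be an algebraically closed field. A *tensor category* over $k$ is a $k$-linear abelian rigid monoidal category with $k$-bilinear tensor product, finite-dimensional Hom spaces, all objects of finite length, and simple unit object $\mathbf 1$; a *braided* tensor category is one endowed with a braiding (a natural isomorphism $X\otimes Y\to Y\otimes X$ satisfying the two hexagon identities). Associativity and unit constraints of $\mathcal C$ are suppressed below. Let $(G,\Gamma)$ be a matched pair of finite groups: there are a left action $\rhd:\Gamma\times G\to G$ and a right action $\lhd:\Gamma\times G\to\Gamma$ on sets with $s\rhd gh=(s\rhd g)((s\lhd g)\rhd h)$ and $st\lhd g=(s\lhd(t\rhd g))(t\lhd g)$. A *$(G,\Gamma)$-crossed tensor category* is a tensor category $\mathcal C$ over $k$ with: * a grading $\mathcal C=\bigoplus_{s\in\Gamma}\mathcal C_s$ by full subcategories closed under isomorphism (every object is a direct sum $\bigoplus_s X_s$ with $X_s\in\mathcal C_s$; $\operatorname{Hom}(\mathcal C_s,\mathcal C_t)=0$ for $s\ne t$; $\mathcal C_s\otimes\mathcal C_t\subseteq\mathcal C_{st}$); * a right action of $G$ by $k$-linear autoequivalences $\rho^g$, with coherent natural isomorphisms $\rho_2^{g,h}:\rho^g\rho^h\to\rho^{hg}$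 and $\rho_0:\mathrm{id}\to\rho^e$, such that $\rho^g(\mathcal C_s)=\mathcal C_{s\lhd g}$ (essential image); * natural isomorphisms $\gamma^g_{X,Y}:\rho^g(X\otimes Y)\to\rho^{t\rhd g}(X)\otimes\rho^g(Y)$ for $X\in\mathcal C$, $Y\in\mathcal C_t$, and isomorphisms $\gamma^g_0:\rho^g(\mathbf 1)\to\mathbf 1$, such that, for all $g,h\in G$, $X\in\mathcal C$, $Y\in\mathcal C_s$, $Z\in\mathcal C_t$: * (a) $(\gamma^{t\rhd g}_{X,Y}\otimes\mathrm{id})\,\gamma^g_{X\otimes Y,Z}=(\mathrm{id}\otimes\gamma^g_{Y,Z})\,\gamma^g_{X,Y\otimes Z}$; * (b) $(\mathrm{id}\otimes\gamma_0^g)\,\gamma^g_{X,\mathbf 1}=\mathrm{id}_{\rho^g(X)}$ and $(\gamma_0^{s\rhd g}\otimes\mathrm{id})\,\gamma^g_{\mathbf 1,Y}=\mathrm{id}_{\rho^g(Y)}$; * (c) $\gamma^{hg}_{X,Y}\,\rho_2^{g,h}=(\rho_2^{(s\lhd h)\rhd g,\,s\rhd h}\otimes\rho_2^{g,h})\,\gamma^g_{\rho^{s\rhd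 h}(X),\rho^h(Y)}\,\rho^g(\gamma^h_{X,Y})$; * (d) $\gamma_0^{hg}\,(\rho_2^{g,h})_{\mathbf 1}=\gamma_0^g\,\rho^g(\gamma_0^h)$; * (e) $\gamma^e_{X,Y}\,(\rho_0)_{X\otimes Y}=(\rho_0)_X\otimes(\rho_0)_Y$ and $\gamma_0^e\,(\rho_0)_{\mathbf 1}=\mathrm{id}_{\mathbf 1}$. The category $\mathcal C^{(G,\Gamma)}$ has as objects the pairs $(X,r)$ with isomorphisms $r^g:\rho^g(X)\to X$ ($g\in G$) satisfying $r^g\rho^g(r^h)=r^{hg}\rho_2^{g,h}$ and $r^e\rho_0=\mathrm{id}$, and as morphisms the morphisms of $\mathcal C$ that commute with these. Its tensor product is $(X,r)\otimes(Y,l)=(X\otimes Y,\tilde r)$, where $\tilde r^g$ is $(r^{s\rhd g}\otimes l^g)\,\gamma^g_{X,Y_s}$ on the summand $\rho^g(X\otimes Y_s)$; its unit object is $(\mathbf 1,\gamma_0)$; its constraints are those of $\mathcal C$. A *$(G,\Gamma)$-crossed braiding* in $\mathcal C$ is a triple $(c,\varphi,\psi)$ of group homomorphisms $\varphi,\psi:\Gamma\to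 G$ and natural isomorphisms $$c_{X,Y}:X\otimes Y\to\rho^{s\prec t}(Y)\otimes\rho^{\psi(t)}(X),\qquad X\in\mathcal C_s,\ Y\in\mathcal C_t,\qquad s\prec t:=t^{-1}\rhd\varphi(s^{-1}),$$ such that, for all $s,t\in\Gamma$, $g\in G$, $$(t^{-1}\lhd\varphi(s^{-1}))st=s\lhd\psi(t),\quad (t\rhd\psi(s))^{-1}=\psi(s^{-1}\lhd\varphi(t^{-1})),\quad (t^{-1}\rhd\varphi(s^{-1}))^{-1}=\varphi(s\lhd\psi(t)),$$ $$\psi(t)g=(t\rhd g)\psi(t\lhd g),\qquad g\,\varphi(s\lhd g)^{-1}=\varphi(s^{-1})(s\rhd g),$$ and, for all $X\in\mathcal C_s$, $Y\in\mathcal C_t$, $Z\in\mathcal C_u$, $g\in G$ (each $c$ being taken for the degrees of its arguments as they result from the grading), 1. $(\rho_2\otimes\rho_2)\,c_{\rho^{t\rhd g}(X),\rho^g(Y)}\,\gamma^g_{X,Y}=(\rho_2\otimes\rho_2)\,\gamma^g_{\rho^{s\prec t}(Y),\rho^{\psi(t)}(X)}\,\rho^g(c_{X,Y})$; 2. $(\mathrm{id}\otimes\gamma^{\psi(u)}_{X,Y})\,c_{X\otimes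 Y,Z}=(\rho_2\otimes\mathrm{id}\otimes\mathrm{id})\,(c_{X,\rho^{t\prec u}(Z)}\otimes\mathrm{id})\,(\mathrm{id}\otimes c_{Y,Z})$; 3. $(\gamma^{s\prec tu}_{Y,Z}\otimes\mathrm{id})\,c_{X,Y\otimes Z}=(\mathrm{id}\otimes\mathrm{id}\otimes\rho_2)\,(\mathrm{id}\otimes c_{\rho^{\psi(t)}(X),Z})\,(c_{X,Y}\otimes\mathrm{id})$. **Theorem.** Let $\mathcal C$ be a $(G,\Gamma)$-crossed tensor category and let $(c,\varphi,\psi)$ be a $(G,\Gamma)$-crossed braiding in $\mathcal C$. Then $\mathcal C^{(G,\Gamma)}$ is a braided tensor category over $k$, with a braiding $(X,r)\otimes(Y,l)\to(Y,l)\otimes(X,r)$ that is given, for any decompositions $X=\bigoplus_{s}X_s$ and $Y=\bigoplus_{t}Y_t$ into homogeneous objects, componentwise by the isomorphisms $$(l^{t^{-1}\rhd\varphi(s^{-1})}\otimes r^{\psi(t)})\,c_{X_s,Y_t}:X_s\otimes Y_t\to Y_{t\lhd(t^{-1}\rhd\varphi(s^{-1}))}\otimes X_{s\lhd\psi(t)},\qquad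 s,t\in\Gamma .$$ -/

import Mathlib

open CategoryTheory MonoidalCategory Limits

universe w v u

noncomputable section

/-- `C` is a tensor category over the field `k`: a `k`-linear abelian rigid monoidal category with
`k`-bilinear tensor product, finite dimensional Hom spaces, objects of finite length and simple
unit object. (The first five fields are those of Mathlib's `Abelian`, for the given preadditive
structure; an object has finite length iff it is Noetherian and Artinian.) -/
class TensorCategory (k : Type w) [Field k] (C : Type u) [Category.{v} C] [Preadditive C]
    [Linear k C] [MonoidalCategory C] [MonoidalPreadditive C] [MonoidalLinear k C] : Prop where
  hasFiniteProducts : HasFiniteProducts C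
  hasKernels : HasKernels C
  hasCokernels : HasCokernels C
  isNormalMonoCategory : IsNormalMonoCategory C
  isNormalEpiCategory : IsNormalEpiCategory C
  rigid : Nonempty (RigidCategory C)
  finiteDimensional_hom : ∀ X Y : C, FiniteDimensional k (X ⟶ Y)
  isNoetherianObject : ∀ X : C, IsNoetherianObject X
  isArtinianObject : ∀ X : C, IsArtinianObject X
  simple_unit : Simple (𝟙_ C)

/-- A matched pair of groups `(G, Γ)`: a left action `s ▷ g` (`lact s g`) of `Γ` on the set `G` and
a right action `s ◁ g` (`ract s g`) of `G` on the set `Γ`, with the two compatibilities. -/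
structure MatchedPair (G Γ : Type*) [Group G] [Group Γ] where
  lact : Γ → G → G
  ract : Γ → G → Γ
  one_lact : ∀ g, lact 1 g = g
  mul_lact : ∀ s t g, lact (s * t) g = lact s (lact t g)
  ract_one : ∀ s, ract s 1 = s
  ract_mul : ∀ s g h, ract s (g * h) = ract (ract s g) h
  lact_mul : ∀ s g h, lact s (g * h) = lact s g * lact (ract s g) h
  mul_ract : ∀ s t g, ract (s * t) g = ract s (lact t g) * ract t g

namespace MatchedPair

variable {G Γ : Type*} [Group G] [Group Γ] (P : MatchedPair G Γ)

lemma lact_one (s : Γ) : P.lact s 1 = 1 := by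
  have h := P.lact_mul s 1 1
  rw [mul_one, P.ract_one] at h
  exact left_eq_mul.1 h

lemma lact_inv_lact (s : Γ) (g : G) : P.lact s⁻¹ (P.lact s g) = g := by
  rw [← P.mul_lact, inv_mul_cancel, P.one_lact]

lemma lact_lact_inv (s : Γ) (g : G) : P.lact s (P.lact s⁻¹ g) = g := by
  rw [← P.mul_lact, mul_inv_cancel, P.one_lact]

lemma one_ract (g : G) : P.ract 1 g = 1 := by
  have h := P.mul_ract 1 1 g
  rw [mul_one, P.one_lact] at h
  exact left_eq_mul.1 h

lemma ract_lact_inv (t : Γ) (g : G) : P.ract t (P.lact t⁻¹ g) = (P.ract t⁻¹ g)⁻¹ := by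
  have h := P.mul_ract t t⁻¹ g
  rw [mul_inv_cancel, P.one_ract] at h
  exact eq_inv_of_mul_eq_one_left h.symm

lemma ract_inv_lact (t : Γ) (g : G) : P.ract t⁻¹ (P.lact t g) = (P.ract t g)⁻¹ := by
  have h := P.ract_lact_inv t⁻¹ g
  rwa [inv_inv] at h

end MatchedPair

/-- A right action of the group `G` on the `k`-linear category `C`, by `k`-linear functors `ρ g`
with natural isomorphisms `ρ₂ g h : ρ^g ρ^h ≅ ρ^{hg}` and `ρ₀ : id ≅ ρ^e`. (The `ρ g` are then
autoequivalences.) -/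
structure RightAction (k : Type w) [Field k] (G : Type*) [Group G] (C : Type u) [Category.{v} C]
    [Preadditive C] [Linear k C] where
  ρ : G → C ⥤ C
  additive : ∀ g, (ρ g).Additive
  linear : ∀ g, (ρ g).Linear k
  ρ₂ : ∀ g h : G, ρ h ⋙ ρ g ≅ ρ (h * g)
  ρ₀ : 𝟭 C ≅ ρ 1
  assoc : ∀ (a b c : G) (X : C),
    (ρ₂ a b).hom.app ((ρ c).obj X) ≫ (ρ₂ (b * a) c).hom.app X =
      (ρ a).map ((ρ₂ b c).hom.app X) ≫ (ρ₂ a (c * b)).hom.app X ≫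
        eqToHom (by rw [mul_assoc])
  unit_left : ∀ (a : G) (X : C),
    (ρ a).map (ρ₀.hom.app X) ≫ (ρ₂ a 1).hom.app X = eqToHom (by rw [one_mul]; rfl)
  unit_right : ∀ (a : G) (X : C),
    ρ₀.hom.app ((ρ a).obj X) ≫ (ρ₂ 1 a).hom.app X = eqToHom (by rw [mul_one]; rfl)

attribute [instance] RightAction.additive RightAction.linear

namespace RightAction

variable {k : Type w} [Field k] {G : Type*} [Group G] {C : Type u} [Category.{v} C]
    [Preadditive C] [Linear k C] (A : RightAction k G C)

/-- The identification `ρ^a(X) = ρ^b(X)` for `a = b`. -/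
def tr {a b : G} (h : a = b) (X : C) : (A.ρ a).obj X ⟶ (A.ρ b).obj X :=
  eqToHom (by rw [h])

lemma faithful (g : G) : (A.ρ g).Faithful :=
  Functor.Faithful.of_comp_iso
    (A.ρ₂ g⁻¹ g ≪≫ eqToIso (by rw [mul_inv_cancel]) ≪≫ A.ρ₀.symm)

/-- An equivariant object `(X, r)`. -/
structure EquivariantObject where
  obj : C
  r : ∀ g : G, (A.ρ g).obj obj ⟶ obj
  isIso_r : ∀ g : G, IsIso (r g)
  r_mul : ∀ g h : G, (A.ρ g).map (r h) ≫ r g = (A.ρ₂ g h).hom.app obj ≫ r (h * g)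
  r_one : A.ρ₀.hom.app obj ≫ r 1 = 𝟙 obj


lemma isIso_of_mul_one {X : C} (r : ∀ g : G, (A.ρ g).obj X ⟶ X)
    (mul : ∀ g h : G, (A.ρ g).map (r h) ≫ r g = (A.ρ₂ g h).hom.app X ≫ r (h * g))
    (one : A.ρ₀.hom.app X ≫ r 1 = 𝟙 X) (g : G) : IsIso (r g) := by
  have h1 : IsIso (r 1) := by
    have h : r 1 = inv (A.ρ₀.hom.app X) := IsIso.eq_inv_of_hom_inv_id one
    rw [h]; infer_instance
  have h2 : ∀ a : G, a = 1 → IsIso (r a) := by rintro _ rfl; exact h1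
  have h3 : ∀ a b : G, b * a = 1 → IsIso ((A.ρ a).map (r b) ≫ r a) := by
    intro a b hab
    have := h2 _ hab
    rw [mul]
    infer_instance
  have := A.faithful g⁻¹
  have := h3 g g⁻¹ (inv_mul_cancel g)
  have hepi : IsSplitEpi (r g) :=
    ⟨⟨⟨inv ((A.ρ g).map (r g⁻¹) ≫ r g) ≫ (A.ρ g).map (r g⁻¹), by
      rw [Category.assoc, IsIso.inv_hom_id]⟩⟩⟩
  have := h3 g⁻¹ g (mul_inv_cancel g)
  have hmono' : Mono ((A.ρ g⁻¹).map (r g)) :=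
    mono_of_mono ((A.ρ g⁻¹).map (r g)) (r g⁻¹)
  have hmono : Mono (r g) := (A.ρ g⁻¹).mono_of_mono_map hmono'
  exact isIso_of_mono_of_isSplitEpi _

variable {A}

namespace EquivariantObject

attribute [instance] isIso_r

lemma tr_r (X : A.EquivariantObject) {a b : G} (h : a = b) :
    A.tr h X.obj ≫ X.r b = X.r a := by
  subst h
  simp [tr]

/-- An equivariant morphism. -/
@[ext]
structure Hom (X Y : A.EquivariantObject) where
  hom : X.obj ⟶ Y.obj
  comm : ∀ g : G, X.r g ≫ hom = (A.ρ g).map hom ≫ Y.r g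

/-- The equivariantization `C^G`. -/
instance : Category A.EquivariantObject where
  Hom := Hom
  id X := ⟨𝟙 _, by simp⟩
  comp f g := ⟨f.hom ≫ g.hom, fun a => by
    rw [← Category.assoc, f.comm, Category.assoc, g.comm, Functor.map_comp, Category.assoc]⟩

@[ext]
lemma hom_ext {X Y : A.EquivariantObject} {f g : X ⟶ Y} (h : f.hom = g.hom) : f = g :=
  Hom.ext h

@[simp]
lemma id_hom (X : A.EquivariantObject) : Hom.hom (𝟙 X) = 𝟙 X.obj := rfl

@[simp]
lemma comp_hom {X Y Z : A.EquivariantObject} (f : X ⟶ Y) (g : Y ⟶ Z) :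
    (f ≫ g).hom = f.hom ≫ g.hom := rfl

/-- An isomorphism of `C` whose direct map is equivariant is one of equivariant objects. -/
def mkIso {X Y : A.EquivariantObject} (e : X.obj ≅ Y.obj)
    (h : ∀ g : G, X.r g ≫ e.hom = (A.ρ g).map e.hom ≫ Y.r g) : X ≅ Y where
  hom := ⟨e.hom, h⟩
  inv := ⟨e.inv, fun g => by
    rw [← cancel_mono e.hom, Category.assoc, Category.assoc, e.inv_hom_id, h,
      ← Functor.map_comp_assoc, e.inv_hom_id]
    simp⟩

@[simp]
lemma mkIso_hom_hom {X Y : A.EquivariantObject} (e : X.obj ≅ Y.obj) (h) :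
    (mkIso e h).hom.hom = e.hom := rfl

@[simp]
lemma mkIso_inv_hom {X Y : A.EquivariantObject} (e : X.obj ≅ Y.obj) (h) :
    (mkIso e h).inv.hom = e.inv := rfl

variable (X Y : A.EquivariantObject)

/-- The equivariant morphisms as a subspace of the morphisms of `C`. -/
def homSubmodule : Submodule k (X.obj ⟶ Y.obj) where
  carrier := {f | ∀ g : G, X.r g ≫ f = (A.ρ g).map f ≫ Y.r g}
  add_mem' {f f'} hf hf' g := by
    rw [Preadditive.comp_add, hf, hf', Functor.map_add, Preadditive.add_comp]
  zero_mem' g := by simp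
  smul_mem' a f hf g := by
    rw [Linear.comp_smul, hf, Functor.map_smul, Linear.smul_comp]

/-- Equivariant morphisms are the elements of `homSubmodule`. -/
def homEquiv : (X ⟶ Y) ≃ homSubmodule X Y where
  toFun f := ⟨f.hom, f.comm⟩
  invFun f := ⟨f.1, f.2⟩
  left_inv _ := rfl
  right_inv _ := rfl

instance : AddCommGroup (X ⟶ Y) := (homEquiv X Y).addCommGroup

instance : Module k (X ⟶ Y) := (homEquiv X Y).module k

variable {X Y}

@[simp]
lemma add_hom (f g : X ⟶ Y) : (f + g).hom = f.hom + g.hom := rfl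

@[simp]
lemma zero_hom : (0 : X ⟶ Y).hom = 0 := rfl

@[simp]
lemma smul_hom (a : k) (f : X ⟶ Y) : (a • f).hom = a • f.hom := rfl

instance : Preadditive A.EquivariantObject where

instance : Linear k A.EquivariantObject where

end EquivariantObject

end RightAction

/-- A grading of the monoidal category `C` by the finite group `Γ`: isomorphism-closed full
subcategories `C_s`, such that each object is a direct sum of homogeneous ones. -/
structure Grading (Γ : Type*) [Group Γ] [Fintype Γ] (C : Type u) [Category.{v} C]
    [Preadditive C] [MonoidalCategory C] where
  deg : Γ → ObjectProperty C
  isClosedUnderIsomorphisms : ∀ s, (deg s).IsClosedUnderIsomorphisms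
  hom_eq_zero : ∀ {s t : Γ} {X Y : C}, deg s X → deg t Y → s ≠ t → ∀ f : X ⟶ Y, f = 0
  tensor_mem : ∀ {s t : Γ} {X Y : C}, deg s X → deg t Y → deg (s * t) (X ⊗ Y)
  exists_decomp : ∀ X : C, ∃ (Y : Γ → C) (ι : ∀ s, Y s ⟶ X) (π : ∀ s, X ⟶ Y s),
    (∀ s, deg s (Y s)) ∧ (∀ s, ι s ≫ π s = 𝟙 (Y s)) ∧
      (∀ s t, s ≠ t → ι s ≫ π t = 0) ∧ ∑ s, π s ≫ ι s = 𝟙 X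

attribute [instance] Grading.isClosedUnderIsomorphisms

namespace Grading

variable {Γ : Type*} [Group Γ] [Fintype Γ] {C : Type u} [Category.{v} C]
    [Preadditive C] [MonoidalCategory C] (𝒢 : Grading Γ C)

/-- A decomposition `X ≅ ⨁ X_s` of `X` as a direct sum of homogeneous objects `X_s ∈ C_s`. -/
structure Decomposition (X : C) where
  comp : Γ → C
  mem : ∀ s, 𝒢.deg s (comp s)
  ι : ∀ s, comp s ⟶ X
  π : ∀ s, X ⟶ comp s
  ι_π_self : ∀ s, ι s ≫ π s = 𝟙 (comp s)
  ι_π_ne : ∀ s t, s ≠ t → ι s ≫ π t = 0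
  sum_π_ι : ∑ s, π s ≫ ι s = 𝟙 X

/-- A chosen decomposition of `X`. -/
def decomp (X : C) : 𝒢.Decomposition X :=
  Nonempty.some <| by
    obtain ⟨Y, ι, π, h₁, h₂, h₃, h₄⟩ := 𝒢.exists_decomp X
    exact ⟨⟨Y, h₁, ι, π, h₂, h₃, h₄⟩⟩

variable {𝒢}

lemma Decomposition.hom_ext {X : C} (D : 𝒢.Decomposition X) (F : C ⥤ C) [F.Additive] {Z : C}
    {f g : F.obj X ⟶ Z} (h : ∀ s, F.map (D.ι s) ≫ f = F.map (D.ι s) ≫ g) : f = g := by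
  rw [← Category.id_comp f, ← Category.id_comp g, ← F.map_id, ← D.sum_π_ι, F.map_sum,
    Preadditive.sum_comp, Preadditive.sum_comp]
  refine Finset.sum_congr rfl fun s _ => ?_
  rw [F.map_comp, Category.assoc, h, Category.assoc]

variable (𝒢)

/-- The unit object of a graded tensor category is homogeneous of trivial degree. -/
lemma unit_mem (k : Type w) [Field k] [Linear k C] [MonoidalPreadditive C] [MonoidalLinear k C]
    [TensorCategory k C] : 𝒢.deg 1 (𝟙_ C) := by
  have hS : Simple (𝟙_ C) := TensorCategory.simple_unit k
  obtain ⟨Y, ι, π, h₁, h₂, h₃, h₄⟩ := 𝒢.exists_decomp (𝟙_ C)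
  have hne : ∃ s, ι s ≠ 0 := by
    by_contra hcon
    push Not at hcon
    apply id_nonzero (𝟙_ C)
    rw [← h₄]
    exact Finset.sum_eq_zero fun s _ => by rw [hcon, comp_zero]
  obtain ⟨s, hs⟩ := hne
  have hm : IsSplitMono (ι s) := ⟨⟨⟨π s, h₂ s⟩⟩⟩
  have hi : IsIso (ι s) := isIso_of_mono_of_nonzero hs
  have hmem : 𝒢.deg s (𝟙_ C) := (𝒢.deg s).prop_of_iso (asIso (ι s)) (h₁ s)
  have hmem' : 𝒢.deg (s * s) (𝟙_ C) :=
    (𝒢.deg (s * s)).prop_of_iso (λ_ (𝟙_ C)) (𝒢.tensor_mem hmem hmem)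
  have hss : s * s = s := by
    by_contra hcon
    exact id_nonzero (𝟙_ C) (𝒢.hom_eq_zero hmem' hmem hcon (𝟙 _))
  rw [mul_eq_right] at hss
  rwa [hss] at hmem

end Grading

/-- A pair of group homomorphisms `φ, ψ : Γ → G` satisfying the five conditions required of the
group-theoretical part of a crossed braiding. -/
structure BraidingHoms {G Γ : Type*} [Group G] [Group Γ] (P : MatchedPair G Γ) where
  φ : Γ →* G
  ψ : Γ →* G
  ract_eq : ∀ s t, P.ract t⁻¹ (φ s⁻¹) * s * t = P.ract s (ψ t)
  lact_ψ : ∀ s t, (P.lact t (ψ s))⁻¹ = ψ (P.ract s⁻¹ (φ t⁻¹))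
  lact_φ : ∀ s t, (P.lact t⁻¹ (φ s⁻¹))⁻¹ = φ (P.ract s (ψ t))
  ψ_mul : ∀ t g, ψ t * g = P.lact t g * ψ (P.ract t g)
  mul_φ : ∀ s g, g * (φ (P.ract s g))⁻¹ = φ s⁻¹ * P.lact s g

namespace BraidingHoms

variable {G Γ : Type*} [Group G] [Group Γ] {P : MatchedPair G Γ} (B : BraidingHoms P)

/-- The element `t⁻¹ ▷ φ(s⁻¹)` of `G`. -/
abbrev lt (s t : Γ) : G := P.lact t⁻¹ (B.φ s⁻¹)

lemma mul_lt (s t : Γ) (g : G) :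
    g * B.lt (P.ract s (P.lact t g)) (P.ract t g) =
      B.lt s t * P.lact (P.ract s (B.ψ t)) g := by
  have h := P.lact_mul t⁻¹ (P.lact t g) (B.φ (P.ract s (P.lact t g)))⁻¹
  rw [P.lact_inv_lact, P.ract_inv_lact, B.mul_φ, P.lact_mul, ← P.mul_lact, ← P.mul_lact,
    B.ract_eq] at h
  rw [lt, lt, map_inv, ← h]

lemma lt_mul_lt (s t u : Γ) : B.lt t u * B.lt s (P.ract u (B.lt t u)) = B.lt (s * t) u := by
  simp only [lt]
  rw [P.ract_lact_inv, inv_inv, mul_inv_rev, map_mul, P.lact_mul]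

lemma ψ_ract_lt (t u : Γ) : B.ψ (P.ract u (B.lt t u)) = P.lact t (B.ψ u) := by
  rw [lt, P.ract_lact_inv, map_inv, ← B.lact_ψ, inv_inv]

lemma lt_eq (s t u : Γ) : B.lt s t = P.lact u (B.lt s (t * u)) := by
  rw [lt, lt, mul_inv_rev, P.mul_lact, P.lact_lact_inv]

lemma lt_ract (s t u : Γ) : B.lt (P.ract s (B.ψ t)) u = B.lt s (t * u) := by
  rw [lt, lt, map_inv, ← B.lact_φ, inv_inv, mul_inv_rev, P.mul_lact]

end BraidingHoms

section Crossed

variable (k : Type w) [Field k] {G Γ : Type*} [Group G] [Group Γ] [Fintype Γ]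
  (P : MatchedPair G Γ) (C : Type u) [Category.{v} C] [Preadditive C] [Linear k C]
  [MonoidalCategory C] [MonoidalPreadditive C] [MonoidalLinear k C] [TensorCategory k C]

/-- A `(G, Γ)`-crossed action on the tensor category `C`. The category `C` is not assumed to be
strict, so associators and unitors appear in the axioms; `tr` is the identification of `ρ^a` with
`ρ^b` for `a = b`. -/
structure CrossedAction extends RightAction k G C, Grading Γ C where
  map_deg : ∀ (g : G) (s : Γ), (deg s).map (ρ g) = deg (P.ract s g)
  γ : ∀ (g : G) {t : Γ} (X : C) {Y : C}, deg t Y →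
    ((ρ g).obj (X ⊗ Y) ≅ (ρ (P.lact t g)).obj X ⊗ (ρ g).obj Y)
  γ_natural : ∀ (g : G) {t : Γ} {X X' Y Y' : C} (hY : deg t Y) (hY' : deg t Y')
    (f : X ⟶ X') (f' : Y ⟶ Y'),
    (ρ g).map (f ⊗ₘ f') ≫ (γ g X' hY').hom =
      (γ g X hY).hom ≫ ((ρ (P.lact t g)).map f ⊗ₘ (ρ g).map f')
  γ₀ : ∀ g : G, (ρ g).obj (𝟙_ C) ≅ 𝟙_ C
  γ_assoc : ∀ (g : G) {s t : Γ} (X : C) {Y Z : C} (hY : deg s Y) (hZ : deg t Z),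
    (γ g (X ⊗ Y) hZ).hom ≫ (γ (P.lact t g) X hY).hom ▷ (ρ g).obj Z ≫ (α_ _ _ _).hom =
      (ρ g).map (α_ X Y Z).hom ≫ (γ g X (tensor_mem hY hZ)).hom ≫
        (toRightAction.tr (P.mul_lact s t g) X ⊗ₘ (γ g Y hZ).hom)
  γ_unit_right : ∀ (g : G) (X : C),
    (γ g X (toGrading.unit_mem k)).hom ≫ (toRightAction.tr (P.one_lact g) X ⊗ₘ (γ₀ g).hom) ≫
      (ρ_ ((ρ g).obj X)).hom = (ρ g).map (ρ_ X).hom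
  γ_unit_left : ∀ (g : G) {t : Γ} {X : C} (hX : deg t X),
    (γ g (𝟙_ C) hX).hom ≫ (γ₀ (P.lact t g)).hom ▷ (ρ g).obj X ≫ (λ_ ((ρ g).obj X)).hom =
      (ρ g).map (λ_ X).hom
  γ_mul : ∀ (g h : G) {s : Γ} (X : C) {Y : C} (hY : deg s Y),
    (ρ₂ g h).hom.app (X ⊗ Y) ≫ (γ (h * g) X hY).hom ≫
        toRightAction.tr (P.lact_mul s h g) X ▷ (ρ (h * g)).obj Y =
      (ρ g).map (γ h X hY).hom ≫ (γ g ((ρ (P.lact s h)).obj X)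
          ((map_deg h s).le _ ((deg s).prop_map_obj (ρ h) hY))).hom ≫
        ((ρ₂ (P.lact (P.ract s h) g) (P.lact s h)).hom.app X ⊗ₘ (ρ₂ g h).hom.app Y)
  γ₀_mul : ∀ g h : G,
    (ρ₂ g h).hom.app (𝟙_ C) ≫ (γ₀ (h * g)).hom = (ρ g).map (γ₀ h).hom ≫ (γ₀ g).hom
  γ_one : ∀ {s : Γ} (X : C) {Y : C} (hY : deg s Y),
    ρ₀.hom.app (X ⊗ Y) ≫ (γ 1 X hY).hom ≫
        toRightAction.tr (P.lact_one s) X ▷ (ρ 1).obj Y =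
      (ρ₀.hom.app X ⊗ₘ ρ₀.hom.app Y)
  γ₀_one : ρ₀.hom.app (𝟙_ C) ≫ (γ₀ 1).hom = 𝟙 (𝟙_ C)

end Crossed

namespace CrossedAction

variable {k : Type w} [Field k] {G Γ : Type*} [Group G] [Group Γ] [Fintype Γ]
  {P : MatchedPair G Γ} {C : Type u} [Category.{v} C] [Preadditive C] [Linear k C]
  [MonoidalCategory C] [MonoidalPreadditive C] [MonoidalLinear k C] [TensorCategory k C]
  (A : CrossedAction k P C)

lemma map_mem (g : G) {s : Γ} {X : C} (hX : A.deg s X) :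
    A.deg (P.ract s g) ((A.ρ g).obj X) := by
  rw [← A.map_deg]
  exact ObjectProperty.prop_map_obj _ _ hX

/-- The naturality of `γ` in its first variable. -/
lemma γ_natural_left (g : G) {t : Γ} {X X' Y : C} (hY : A.deg t Y) (f : X ⟶ X') :
    (A.ρ g).map (f ▷ Y) ≫ (A.γ g X' hY).hom =
      (A.γ g X hY).hom ≫ (A.ρ (P.lact t g)).map f ▷ (A.ρ g).obj Y := by
  have h := A.γ_natural g hY hY f (𝟙 Y)
  rwa [tensorHom_id, CategoryTheory.Functor.map_id, tensorHom_id] at h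

/-- The naturality of `γ` in its second variable. -/
lemma γ_natural_right (g : G) {t : Γ} (X : C) {Y Y' : C} (hY : A.deg t Y) (hY' : A.deg t Y')
    (f : Y ⟶ Y') :
    (A.ρ g).map (X ◁ f) ≫ (A.γ g X hY').hom =
      (A.γ g X hY).hom ≫ (A.ρ (P.lact t g)).obj X ◁ (A.ρ g).map f := by
  have h := A.γ_natural g hY hY' (𝟙 X) f
  rwa [id_tensorHom, CategoryTheory.Functor.map_id, id_tensorHom] at h

/-- The category `C^{(G, Γ)}`, whose underlying `k`-linear category is the equivariantization. -/
abbrev Equivariantization := A.toRightAction.EquivariantObject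

variable {A}

/-- The action `r̃^g` on `X ⊗ Y`: on the summand `ρ^g(X ⊗ Y_s)` of `ρ^g(X ⊗ Y)` it is the
composition of `γ^g_{X, Y_s}` and `r^{s ▷ g} ⊗ r'^g`. -/
def tensorR (X Y : A.Equivariantization) (g : G) :
    (A.ρ g).obj (X.obj ⊗ Y.obj) ⟶ X.obj ⊗ Y.obj :=
  ∑ s : Γ, (A.ρ g).map (X.obj ◁ (A.decomp Y.obj).π s) ≫
    (A.γ g X.obj ((A.decomp Y.obj).mem s)).hom ≫
      (X.r (P.lact s g) ⊗ₘ ((A.ρ g).map ((A.decomp Y.obj).ι s) ≫ Y.r g))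

lemma map_tensorR (X Y : A.Equivariantization) (g : G) {s : Γ} {Z : C} (hZ : A.deg s Z)
    (f : Z ⟶ Y.obj) :
    (A.ρ g).map (X.obj ◁ f) ≫ tensorR X Y g =
      (A.γ g X.obj hZ).hom ≫ (X.r (P.lact s g) ⊗ₘ ((A.ρ g).map f ≫ Y.r g)) := by
  have hf : f = (f ≫ (A.decomp Y.obj).π s) ≫ (A.decomp Y.obj).ι s := by
    conv_lhs => rw [← Category.comp_id f, ← (A.decomp Y.obj).sum_π_ι, Preadditive.comp_sum]
    rw [Finset.sum_eq_single s, Category.assoc]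
    · intro t _ ht
      rw [← Category.assoc, A.hom_eq_zero hZ ((A.decomp Y.obj).mem t) ht.symm (f ≫ _), zero_comp]
    · intro h; exact absurd (Finset.mem_univ s) h
  rw [tensorR, Preadditive.comp_sum, Finset.sum_eq_single s]
  · rw [← Functor.map_comp_assoc, ← MonoidalCategory.whiskerLeft_comp,
      reassoc_of% (A.γ_natural_right g X.obj hZ ((A.decomp Y.obj).mem s))]
    congr 1
    rw [← id_tensorHom, tensorHom_comp_tensorHom, Category.id_comp, ← Functor.map_comp_assoc, ← hf]
  · intro t _ ht
    rw [← Functor.map_comp_assoc, ← MonoidalCategory.whiskerLeft_comp,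
      A.hom_eq_zero hZ ((A.decomp Y.obj).mem t) ht.symm (f ≫ _)]
    simp
  · intro h; exact absurd (Finset.mem_univ s) h

lemma tensorR_mul (X Y : A.Equivariantization) (g h : G) :
    (A.ρ g).map (tensorR X Y h) ≫ tensorR X Y g =
      (A.ρ₂ g h).hom.app (X.obj ⊗ Y.obj) ≫ tensorR X Y (h * g) := by
  apply (A.decomp Y.obj).hom_ext (tensorLeft X.obj ⋙ A.ρ h ⋙ A.ρ g)
  intro s
  set D := A.decomp Y.obj
  have hs := D.mem s
  have hs' := A.map_mem h hs
  have e1 : (A.ρ g).map ((A.ρ h).map (X.obj ◁ D.ι s)) ≫ (A.ρ g).map (tensorR X Y h) ≫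
      tensorR X Y g = (A.ρ g).map (A.γ h X.obj hs).hom ≫
        (A.γ g ((A.ρ (P.lact s h)).obj X.obj) hs').hom ≫
          (((A.ρ (P.lact (P.ract s h) g)).map (X.r (P.lact s h)) ≫
              X.r (P.lact (P.ract s h) g)) ⊗ₘ
            ((A.ρ g).map ((A.ρ h).map (D.ι s) ≫ Y.r h) ≫ Y.r g)) := by
    rw [← Functor.map_comp_assoc, map_tensorR X Y h hs, MonoidalCategory.tensorHom_def, Functor.map_comp,
      Functor.map_comp, Category.assoc, Category.assoc, map_tensorR X Y g hs',
      reassoc_of% (A.γ_natural_left g hs')]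
    congr 2
    rw [← tensorHom_id, tensorHom_comp_tensorHom, Category.id_comp]
  have e2 : (A.ρ g).map ((A.ρ h).map (X.obj ◁ D.ι s)) ≫
      (A.ρ₂ g h).hom.app (X.obj ⊗ Y.obj) ≫ tensorR X Y (h * g) =
        (A.ρ₂ g h).hom.app (X.obj ⊗ D.comp s) ≫ (A.γ (h * g) X.obj hs).hom ≫
          (X.r (P.lact s (h * g)) ⊗ₘ ((A.ρ (h * g)).map (D.ι s) ≫ Y.r (h * g))) := by
    have := (A.ρ₂ g h).hom.naturality (X.obj ◁ D.ι s)
    dsimp at this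
    rw [reassoc_of% this, map_tensorR X Y (h * g) hs]
  dsimp
  rw [e1, e2, X.r_mul, Functor.map_comp, Category.assoc, Y.r_mul]
  have hn := (A.ρ₂ g h).hom.naturality (D.ι s)
  dsimp at hn
  rw [reassoc_of% hn, ← tensorHom_comp_tensorHom,
    ← reassoc_of% (A.γ_mul g h X.obj hs), ← tensorHom_id, tensorHom_comp_tensorHom,
    X.tr_r, Category.id_comp]

lemma tensorR_one (X Y : A.Equivariantization) :
    A.ρ₀.hom.app (X.obj ⊗ Y.obj) ≫ tensorR X Y 1 = 𝟙 _ := by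
  apply (A.decomp Y.obj).hom_ext (tensorLeft X.obj)
  intro s
  set D := A.decomp Y.obj
  have h := A.ρ₀.hom.naturality (X.obj ◁ D.ι s)
  dsimp at h ⊢
  have hn := A.ρ₀.hom.naturality (D.ι s)
  dsimp at hn
  rw [reassoc_of% h, map_tensorR X Y 1 (D.mem s), ← X.tr_r (P.lact_one s),
    ← Category.id_comp ((A.ρ 1).map (D.ι s) ≫ _), ← tensorHom_comp_tensorHom, tensorHom_id,
    reassoc_of% (A.γ_one X.obj (D.mem s)), tensorHom_comp_tensorHom, X.r_one, ← reassoc_of% hn,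
    Y.r_one]
  simp

/-- The tensor product `(X, r) ⊗ (Y, r') = (X ⊗ Y, r̃)`. -/
abbrev tensorObj (X Y : A.Equivariantization) : A.Equivariantization where
  obj := X.obj ⊗ Y.obj
  r := tensorR X Y
  isIso_r := A.isIso_of_mul_one _ (tensorR_mul X Y) (tensorR_one X Y)
  r_mul := tensorR_mul X Y
  r_one := tensorR_one X Y

variable (A) in
/-- The unit object `(𝟙, γ₀)`. -/
abbrev tensorUnit : A.Equivariantization where
  obj := 𝟙_ C
  r g := (A.γ₀ g).hom
  isIso_r _ := inferInstance
  r_mul g h := (A.γ₀_mul g h).symm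
  r_one := A.γ₀_one

lemma tensorR_naturality {X X' Y Y' : A.Equivariantization} (f : X ⟶ X') (f' : Y ⟶ Y') (g : G) :
    tensorR X Y g ≫ (f.hom ⊗ₘ f'.hom) = (A.ρ g).map (f.hom ⊗ₘ f'.hom) ≫ tensorR X' Y' g := by
  apply (A.decomp Y.obj).hom_ext (tensorLeft X.obj ⋙ A.ρ g)
  intro s
  set D := A.decomp Y.obj
  have hs := D.mem s
  have e : X.obj ◁ D.ι s ≫ (f.hom ⊗ₘ f'.hom) =
      f.hom ▷ D.comp s ≫ X'.obj ◁ (D.ι s ≫ f'.hom) := by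
    rw [← id_tensorHom, ← tensorHom_id, ← id_tensorHom, tensorHom_comp_tensorHom,
      tensorHom_comp_tensorHom]
    simp
  dsimp
  rw [← Functor.map_comp_assoc, e, Functor.map_comp, Category.assoc, map_tensorR X' Y' g hs,
    reassoc_of% (A.γ_natural_left g hs), reassoc_of% (map_tensorR X Y g hs)]
  congr 1
  rw [← tensorHom_id, tensorHom_comp_tensorHom, tensorHom_comp_tensorHom, f.comm, Category.assoc,
    f'.comm, Functor.map_comp, Category.id_comp, Category.assoc]

lemma tensorR_associator (X Y Z : A.Equivariantization) (g : G) :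
    tensorR (tensorObj X Y) Z g ≫ (α_ X.obj Y.obj Z.obj).hom =
      (A.ρ g).map (α_ X.obj Y.obj Z.obj).hom ≫ tensorR X (tensorObj Y Z) g := by
  apply (A.decomp Z.obj).hom_ext (tensorLeft (X.obj ⊗ Y.obj) ⋙ A.ρ g)
  intro t
  set D := A.decomp Z.obj
  have ht := D.mem t
  apply (A.decomp Y.obj).hom_ext (tensorLeft X.obj ⋙ tensorRight (D.comp t) ⋙ A.ρ g)
  intro s
  set D' := A.decomp Y.obj
  have hs := D'.mem s
  have e1 := map_tensorR (tensorObj X Y) Z g ht (D.ι t)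
  have e2 := map_tensorR X (tensorObj Y Z) g (A.tensor_mem hs ht) (D'.ι s ⊗ₘ D.ι t)
  have e3 : (X.obj ◁ D'.ι s) ▷ D.comp t ≫ (X.obj ⊗ Y.obj) ◁ D.ι t ≫
      (α_ X.obj Y.obj Z.obj).hom = (α_ _ _ _).hom ≫ X.obj ◁ (D'.ι s ⊗ₘ D.ι t) := by
    simp [MonoidalCategory.tensorHom_def]
  have e4 : (A.ρ g).map (D'.ι s ⊗ₘ D.ι t) ≫ tensorR Y Z g = (A.γ g (D'.comp s) ht).hom ≫
      (((A.ρ (P.lact t g)).map (D'.ι s) ≫ Y.r (P.lact t g)) ⊗ₘ ((A.ρ g).map (D.ι t) ≫ Z.r g)) := by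
    rw [MonoidalCategory.tensorHom_def, Functor.map_comp, Category.assoc, map_tensorR Y Z g ht,
      reassoc_of% (A.γ_natural_left g ht), ← tensorHom_id, tensorHom_comp_tensorHom,
      Category.id_comp]
  dsimp at e1 e2 ⊢
  rw [e4] at e2
  rw [reassoc_of% e1, ← Functor.map_comp_assoc, ← Functor.map_comp_assoc, Category.assoc, e3,
    Functor.map_comp, Category.assoc, e2, reassoc_of% (A.γ_natural_left g ht)]
  rw [← X.tr_r (P.mul_lact s t g), ← tensorHom_comp_tensorHom,
    ← reassoc_of% (A.γ_assoc g X.obj hs ht)]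
  congr 1
  rw [← associator_naturality, ← tensorHom_id, ← tensorHom_id, tensorHom_comp_tensorHom_assoc,
    tensorHom_comp_tensorHom_assoc, map_tensorR X Y (P.lact t g) hs]

lemma tensorR_leftUnitor (X : A.Equivariantization) (g : G) :
    tensorR (tensorUnit A) X g ≫ (λ_ X.obj).hom = (A.ρ g).map (λ_ X.obj).hom ≫ X.r g := by
  apply (A.decomp X.obj).hom_ext (tensorLeft (𝟙_ C) ⋙ A.ρ g)
  intro s
  set D := A.decomp X.obj
  have e := map_tensorR (tensorUnit A) X g (D.mem s) (D.ι s)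
  dsimp at e ⊢
  rw [reassoc_of% e, ← Functor.map_comp_assoc, leftUnitor_naturality, Functor.map_comp,
    Category.assoc, ← A.γ_unit_left g (D.mem s), MonoidalCategory.tensorHom_def]
  simp

lemma tensorR_rightUnitor (X : A.Equivariantization) (g : G) :
    tensorR X (tensorUnit A) g ≫ (ρ_ X.obj).hom = (A.ρ g).map (ρ_ X.obj).hom ≫ X.r g := by
  have e := map_tensorR X (tensorUnit A) g (A.unit_mem k) (𝟙 _)
  have e' := A.γ_unit_right g X.obj
  dsimp at e
  rw [MonoidalCategory.whiskerLeft_id, CategoryTheory.Functor.map_id, CategoryTheory.Functor.map_id, Category.id_comp,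
    Category.id_comp] at e
  rw [e, ← e', ← X.tr_r (P.one_lact g), Category.assoc, Category.assoc, Category.assoc,
    ← rightUnitor_naturality, ← tensorHom_id, tensorHom_comp_tensorHom_assoc, Category.comp_id]

instance : MonoidalCategoryStruct A.Equivariantization where
  tensorObj := tensorObj
  tensorUnit := tensorUnit A
  tensorHom f f' := ⟨f.hom ⊗ₘ f'.hom, tensorR_naturality f f'⟩
  whiskerLeft X _ _ f := ⟨X.obj ◁ f.hom, by
    have := tensorR_naturality (𝟙 X) f
    rwa [RightAction.EquivariantObject.id_hom, id_tensorHom] at this⟩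
  whiskerRight f X := ⟨f.hom ▷ X.obj, by
    have := tensorR_naturality f (𝟙 X)
    rwa [RightAction.EquivariantObject.id_hom, tensorHom_id] at this⟩
  associator X Y Z := RightAction.EquivariantObject.mkIso (α_ X.obj Y.obj Z.obj)
    (tensorR_associator X Y Z)
  leftUnitor X := RightAction.EquivariantObject.mkIso (λ_ X.obj) (tensorR_leftUnitor X)
  rightUnitor X := RightAction.EquivariantObject.mkIso (ρ_ X.obj) (tensorR_rightUnitor X)

section

variable {X X' Y Y' Z : A.Equivariantization}

@[simp]
lemma tensor_obj : (X ⊗ Y).obj = X.obj ⊗ Y.obj := rfl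

@[simp]
lemma unit_obj : (𝟙_ A.Equivariantization).obj = 𝟙_ C := rfl

@[simp]
lemma tensorHom_hom (f : X ⟶ X') (f' : Y ⟶ Y') : (f ⊗ₘ f').hom = f.hom ⊗ₘ f'.hom := rfl

@[simp]
lemma whiskerLeft_hom (f : Y ⟶ Y') : (X ◁ f).hom = X.obj ◁ f.hom := rfl

@[simp]
lemma whiskerRight_hom (f : X ⟶ X') : (f ▷ Y).hom = f.hom ▷ Y.obj := rfl

@[simp]
lemma associator_hom_hom : (α_ X Y Z).hom.hom = (α_ X.obj Y.obj Z.obj).hom := rfl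

@[simp]
lemma associator_inv_hom : (α_ X Y Z).inv.hom = (α_ X.obj Y.obj Z.obj).inv := rfl

@[simp]
lemma leftUnitor_hom_hom : (λ_ X).hom.hom = (λ_ X.obj).hom := rfl

@[simp]
lemma leftUnitor_inv_hom : (λ_ X).inv.hom = (λ_ X.obj).inv := rfl

@[simp]
lemma rightUnitor_hom_hom : (ρ_ X).hom.hom = (ρ_ X.obj).hom := rfl

@[simp]
lemma rightUnitor_inv_hom : (ρ_ X).inv.hom = (ρ_ X.obj).inv := rfl

end

/-- The monoidal category `C^{(G, Γ)}`. -/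
instance : MonoidalCategory A.Equivariantization where
  tensorHom_def f g := by ext; simp [MonoidalCategory.tensorHom_def]
  id_tensorHom_id X Y := by ext; simp
  tensorHom_comp_tensorHom f₁ f₂ g₁ g₂ := by ext; simp
  whiskerLeft_id X Y := by ext; simp
  id_whiskerRight X Y := by ext; simp
  associator_naturality f₁ f₂ f₃ := by ext; simp
  leftUnitor_naturality f := by ext; simp
  rightUnitor_naturality f := by ext; simp
  pentagon W X Y Z := by ext; simp
  triangle X Y := by ext; simp

instance : MonoidalPreadditive A.Equivariantization where
  whiskerLeft_zero := RightAction.EquivariantObject.hom_ext MonoidalPreadditive.whiskerLeft_zero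
  zero_whiskerRight := RightAction.EquivariantObject.hom_ext MonoidalPreadditive.zero_whiskerRight
  whiskerLeft_add f g :=
    RightAction.EquivariantObject.hom_ext (MonoidalPreadditive.whiskerLeft_add f.hom g.hom)
  add_whiskerRight f g :=
    RightAction.EquivariantObject.hom_ext (MonoidalPreadditive.add_whiskerRight f.hom g.hom)

instance : MonoidalLinear k A.Equivariantization where
  whiskerLeft_smul X _ _ a f :=
    RightAction.EquivariantObject.hom_ext (MonoidalLinear.whiskerLeft_smul X.obj a f.hom)
  smul_whiskerRight a _ _ f X :=
    RightAction.EquivariantObject.hom_ext (MonoidalLinear.smul_whiskerRight a f.hom X.obj)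

variable (A) in
/-- A `(G, Γ)`-crossed braiding `(c, φ, ψ)` in the `(G, Γ)`-crossed tensor category `C`. -/
structure CrossedBraiding extends BraidingHoms P where
  c : ∀ {s t : Γ} {X Y : C}, A.deg s X → A.deg t Y →
    (X ⊗ Y ≅ (A.ρ (P.lact t⁻¹ (φ s⁻¹))).obj Y ⊗ (A.ρ (ψ t)).obj X)
  c_natural : ∀ {s t : Γ} {X X' Y Y' : C} (hX : A.deg s X) (hX' : A.deg s X')
    (hY : A.deg t Y) (hY' : A.deg t Y') (f : X ⟶ X') (f' : Y ⟶ Y'),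
    (f ⊗ₘ f') ≫ (c hX' hY').hom =
      (c hX hY).hom ≫ ((A.ρ (P.lact t⁻¹ (φ s⁻¹))).map f' ⊗ₘ (A.ρ (ψ t)).map f)
  c_equivariant : ∀ (g : G) {s t : Γ} {X Y : C} (hX : A.deg s X) (hY : A.deg t Y),
    (A.γ g X hY).hom ≫ (c (A.map_mem (P.lact t g) hX) (A.map_mem g hY)).hom ≫
        ((A.ρ₂ (toBraidingHoms.lt (P.ract s (P.lact t g)) (P.ract t g)) g).hom.app Y ⊗ₘ
          (A.ρ₂ (ψ (P.ract t g)) (P.lact t g)).hom.app X) ≫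
        (A.tr (toBraidingHoms.mul_lt s t g) Y ⊗ₘ A.tr (ψ_mul t g).symm X) =
      (A.ρ g).map (c hX hY).hom ≫
        (A.γ g ((A.ρ (toBraidingHoms.lt s t)).obj Y) (A.map_mem (ψ t) hX)).hom ≫
        ((A.ρ₂ (P.lact (P.ract s (ψ t)) g) (toBraidingHoms.lt s t)).hom.app Y ⊗ₘ
          (A.ρ₂ g (ψ t)).hom.app X)
  c_tensor_left : ∀ {s t u : Γ} {X Y Z : C} (hX : A.deg s X) (hY : A.deg t Y) (hZ : A.deg u Z),
    (α_ X Y Z).inv ≫ (c (A.tensor_mem hX hY) hZ).hom ≫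
        (A.ρ (toBraidingHoms.lt (s * t) u)).obj Z ◁ (A.γ (ψ u) X hY).hom =
      X ◁ (c hY hZ).hom ≫ (α_ _ _ _).inv ≫
        (c hX (A.map_mem (toBraidingHoms.lt t u) hZ)).hom ▷ (A.ρ (ψ u)).obj Y ≫
        (α_ _ _ _).hom ≫
        (((A.ρ₂ (toBraidingHoms.lt s (P.ract u (toBraidingHoms.lt t u)))
              (toBraidingHoms.lt t u)).hom.app Z ≫ A.tr (toBraidingHoms.lt_mul_lt s t u) Z) ⊗ₘ
          A.tr (toBraidingHoms.ψ_ract_lt t u) X ▷ (A.ρ (ψ u)).obj Y)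
  c_tensor_right : ∀ {s t u : Γ} {X Y Z : C} (hX : A.deg s X) (hY : A.deg t Y) (hZ : A.deg u Z),
    (α_ X Y Z).hom ≫ (c hX (A.tensor_mem hY hZ)).hom ≫
        (A.γ (toBraidingHoms.lt s (t * u)) Y hZ).hom ▷ (A.ρ (ψ (t * u))).obj X ≫
        (α_ _ _ _).hom =
      (c hX hY).hom ▷ Z ≫ (α_ _ _ _).hom ≫
        (A.ρ (toBraidingHoms.lt s t)).obj Y ◁ (c (A.map_mem (ψ t) hX) hZ).hom ≫
        (A.tr (toBraidingHoms.lt_eq s t u) Y ⊗ₘ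
          (A.tr (toBraidingHoms.lt_ract s t u) Z ⊗ₘ
            ((A.ρ₂ (ψ u) (ψ t)).hom.app X ≫ A.tr (ψ.map_mul t u).symm X)))

/-- The component `r^g_s : ρ^g(X_s) → X_{s ◁ g}` of `r^g` with respect to a decomposition of `X` into
homogeneous objects. -/
def rComp (X : A.Equivariantization) (D : A.Decomposition X.obj) (g : G) (s : Γ) :
    (A.ρ g).obj (D.comp s) ⟶ D.comp (P.ract s g) :=
  (A.ρ g).map (D.ι s) ≫ X.r g ≫ D.π (P.ract s g)

/-- The morphism `(l^{t⁻¹ ▷ φ(s⁻¹)} ⊗ r^{ψ(t)}) c_{X_s, Y_t}`. -/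
def CrossedBraiding.braidingComp (B : A.CrossedBraiding) (X Y : A.Equivariantization)
    (D : A.Decomposition X.obj) (E : A.Decomposition Y.obj) (s t : Γ) :
    D.comp s ⊗ E.comp t ⟶
      E.comp (P.ract t (P.lact t⁻¹ (B.φ s⁻¹))) ⊗ D.comp (P.ract s (B.ψ t)) :=
  (B.c (D.mem s) (E.mem t)).hom ≫
    (rComp Y E (P.lact t⁻¹ (B.φ s⁻¹)) t ⊗ₘ rComp X D (B.ψ t) s)

end CrossedAction

end

/-!
Write `ρ^g(U) → X` for the translate by `g` of a morphism `U → X` to an equivariant object. If `U`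
and `V` are homogeneous, then `c_{U,V}` followed by the translates of `U → X` and `V → Y` extends
the braiding along `U ⊗ V → X ⊗ Y`; by naturality of `c` it does not depend on how `X` and `Y` are
decomposed, and naturality, equivariance and the hexagons can be checked on homogeneous summands,
where they become the conditions on a crossed braiding. The braiding is invertible because it
carries the summands of `X ⊗ Y` isomorphically to those of `Y ⊗ X`, by a permutation of the
degrees.

The forgetful functor to `C` is conservative and creates limits and colimits, so `C^{(G, Γ)}` is
abelian and inherits the finiteness conditions from `C`. For rigidity, let `Y` be the right dual of
`X` in `C`. The evaluation `ε : Y ⊗ X → 𝟙` has to become equivariant; as `γ` twists the group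
element by the degree of the second factor, this forces `r^a` on `Y` to pair with the image of
`ρ^g(X_s)` under `r^g`, where `s ▷ g = a`, as the translate of `ε` by `g`, and so determines it.
Left duals then come from the braiding.
-/

noncomputable section

section Conservative

variable {D : Type*} [Category* D] {C : Type u} [Category.{v} C] (F : D ⥤ C)
  [F.ReflectsIsomorphisms]

/-- The abelian structure reflected by a conservative exact functor. -/
@[reducible]
def abelianOfExactConservative [Preadditive D] [Abelian C] [HasFiniteProducts D] [HasKernels D]
    [HasCokernels D] [F.PreservesZeroMorphisms] [PreservesFiniteLimits F]
    [PreservesFiniteColimits F] : Abelian D :=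
  have {X Y : D} (f : X ⟶ Y) : IsIso (Abelian.coimageImageComparison f) := by
    rw [← isIso_iff_of_reflects_iso _ F, Arrow.isIso_iff_isIso_of_isIso
      (Abelian.PreservesCoimageImageComparison.iso F f).hom]
    infer_instance
  .ofCoimageImageComparisonIsIso

section Subobject

variable [F.PreservesMonomorphisms] {X : D}

lemma strictMono_subobject_mk_map :
    StrictMono fun S : Subobject X => Subobject.mk (F.map S.arrow) := fun S T h =>
  Subobject.mk_lt_mk_of_comm (F.map (S.ofLE T h.le)) (by rw [← F.map_comp, Subobject.ofLE_arrow])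
    fun _ =>
      have := isIso_of_reflects_iso (S.ofLE T h.le) F
      h.not_ge (Subobject.le_of_comm (inv (S.ofLE T h.le)) (by simp))

lemma isNoetherianObject_of_obj [IsNoetherianObject (F.obj X)] : IsNoetherianObject X :=
  ⟨(strictMono_subobject_mk_map F).wellFoundedGT⟩

lemma isArtinianObject_of_obj [IsArtinianObject (F.obj X)] : IsArtinianObject X :=
  ⟨(strictMono_subobject_mk_map F).wellFoundedLT⟩

end Subobject

end Conservative

namespace TensorCategory

variable (k : Type w) [Field k] {C : Type u} [Category.{v} C] [Preadditive C] [Linear k C]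
  [MonoidalCategory C] [MonoidalPreadditive C] [MonoidalLinear k C] [TensorCategory k C]

variable (C) in
/-- The abelian structure of a tensor category, over its given preadditive structure. -/
@[reducible]
def abelian : Abelian C where
  toIsNormalMonoCategory := isNormalMonoCategory k
  toIsNormalEpiCategory := isNormalEpiCategory k
  has_finite_products := hasFiniteProducts k
  has_kernels := hasKernels k
  has_cokernels := hasCokernels k

lemma of_exact_conservative {D : Type*} [Category* D] [Preadditive D] [Linear k D]
    [MonoidalCategory D] [MonoidalPreadditive D] [MonoidalLinear k D] [RigidCategory D]
    [HasFiniteLimits D] [HasFiniteColimits D] (F : D ⥤ C) [F.Additive] [F.Linear k]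
    [F.Faithful] [F.ReflectsIsomorphisms] [PreservesFiniteLimits F] [PreservesFiniteColimits F]
    (e : F.obj (𝟙_ D) ≅ 𝟙_ C) : TensorCategory k D := by
  let _ : Abelian C := abelian k C
  let _ : Abelian D := abelianOfExactConservative F
  have : Simple (𝟙_ C) := simple_unit k
  have : Simple (F.obj (𝟙_ D)) := .of_iso e
  exact
    { hasFiniteProducts := inferInstance
      hasKernels := inferInstance
      hasCokernels := inferInstance
      isNormalMonoCategory := inferInstance
      isNormalEpiCategory := inferInstance
      rigid := ⟨inferInstance⟩
      finiteDimensional_hom := fun X Y =>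
        have := finiteDimensional_hom (k := k) (F.obj X) (F.obj Y)
        Module.Finite.of_injective (F.mapLinearMap k) (F.map_injective (X := X) (Y := Y))
      isNoetherianObject := fun X =>
        have := isNoetherianObject k (F.obj X)
        isNoetherianObject_of_obj F
      isArtinianObject := fun X =>
        have := isArtinianObject k (F.obj X)
        isArtinianObject_of_obj F
      simple_unit := F.simple_of_simple_obj _ }

end TensorCategory

namespace RightAction

variable {k : Type w} [Field k] {G : Type*} [Group G] {C : Type u} [Category.{v} C]
  [Preadditive C] [Linear k C] (A : RightAction k G C)

/-- The isomorphism `ρ^g ρ^h ≅ id` for mutually inverse `g` and `h`. -/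
def compIsoOfMulEqOne {g h : G} (e : h * g = 1) : A.ρ h ⋙ A.ρ g ≅ 𝟭 C :=
  A.ρ₂ g h ≪≫ eqToIso (congrArg A.ρ e) ≪≫ A.ρ₀.symm

instance isEquivalence_ρ (g : G) : (A.ρ g).IsEquivalence :=
  (CategoryTheory.Equivalence.mk (A.ρ g) (A.ρ g⁻¹) (A.compIsoOfMulEqOne (mul_inv_cancel g)).symm
    (A.compIsoOfMulEqOne (inv_mul_cancel g))).isEquivalence_functor

lemma ρ₂_naturality (g h : G) {X Y : C} (f : X ⟶ Y) :
    (A.ρ g).map ((A.ρ h).map f) ≫ (A.ρ₂ g h).hom.app Y =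
      (A.ρ₂ g h).hom.app X ≫ (A.ρ (h * g)).map f :=
  (A.ρ₂ g h).hom.naturality f

lemma ρ₀_naturality {X Y : C} (f : X ⟶ Y) :
    f ≫ A.ρ₀.hom.app Y = A.ρ₀.hom.app X ≫ (A.ρ 1).map f :=
  A.ρ₀.hom.naturality f

namespace EquivariantObject

variable {A}

/-- The equivariant object given by an object with morphisms `r^g` satisfying the two identities,
which force the `r^g` to be invertible. -/
def ofMulOne (X : C) (r : ∀ g : G, (A.ρ g).obj X ⟶ X)
    (mul : ∀ g h : G, (A.ρ g).map (r h) ≫ r g = (A.ρ₂ g h).hom.app X ≫ r (h * g))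
    (one : A.ρ₀.hom.app X ≫ r 1 = 𝟙 X) : A.EquivariantObject where
  obj := X
  r := r
  isIso_r := A.isIso_of_mul_one r mul one
  r_mul := mul
  r_one := one

variable (A) in
/-- The forgetful functor from equivariant objects to the underlying category. -/
def forget : A.EquivariantObject ⥤ C where
  obj X := X.obj
  map f := f.hom

instance : (forget A).Additive where

instance : (forget A).Linear k where

instance : (forget A).Faithful where
  map_injective h := hom_ext h

instance : (forget A).ReflectsIsomorphisms where
  reflects f (_ : IsIso f.hom) := (mkIso (asIso f.hom) f.comm).isIso_hom

variable (A) in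
/-- The structure morphisms `r^g` as a natural transformation. -/
def rNatTrans (g : G) : forget A ⋙ A.ρ g ⟶ forget A where
  app X := X.r g
  naturality _ _ f := (f.comm g).symm

section JointlyMono

variable {ι : Type*} {Y : ι → A.EquivariantObject}

/-- The equivariant object given by an object `X` with a jointly monic family of morphisms to
equivariant objects, compatible with morphisms `r^g : ρ^g(X) → X`. -/
def ofJointlyMono {X : C} (p : ∀ i, X ⟶ (Y i).obj)
    (hp : ∀ {Z : C} {f f' : Z ⟶ X}, (∀ i, f ≫ p i = f' ≫ p i) → f = f')
    (r : ∀ g, (A.ρ g).obj X ⟶ X) (hr : ∀ g i, r g ≫ p i = (A.ρ g).map (p i) ≫ (Y i).r g) :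
    A.EquivariantObject :=
  ofMulOne X r
    (fun g h => hp fun i => by
      rw [Category.assoc, hr, ← Functor.map_comp_assoc, hr, Functor.map_comp_assoc, (Y i).r_mul,
        Category.assoc, hr, reassoc_of% (A.ρ₂_naturality g h (p i))])
    (hp fun i => by
      dsimp only [Functor.id_obj]
      rw [Category.assoc, hr, ← reassoc_of% (A.ρ₀_naturality (p i)), (Y i).r_one, Category.comp_id,
        Category.id_comp])

lemma comm_of_jointlyMono {W X : A.EquivariantObject} (p : ∀ i, X ⟶ Y i)
    (hp : ∀ {Z : C} {f f' : Z ⟶ X.obj}, (∀ i, f ≫ (p i).hom = f' ≫ (p i).hom) → f = f')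
    {f : W.obj ⟶ X.obj} (q : ∀ i, W ⟶ Y i) (hq : ∀ i, f ≫ (p i).hom = (q i).hom) (g : G) :
    W.r g ≫ f = (A.ρ g).map f ≫ X.r g :=
  hp fun i => by
    rw [Category.assoc, hq, Category.assoc, (p i).comm, ← Functor.map_comp_assoc, hq, (q i).comm]

end JointlyMono

section JointlyEpi

variable {ι : Type*} {Y : ι → A.EquivariantObject}

/-- The equivariant object given by an object `X` with a jointly epic family of morphisms from
equivariant objects, compatible with morphisms `r^g : ρ^g(X) → X`. -/
def ofJointlyEpi {X : C} (p : ∀ i, (Y i).obj ⟶ X)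
    (hp : ∀ (F : C ⥤ C) [F.IsEquivalence] {Z : C} {f f' : F.obj X ⟶ Z},
      (∀ i, F.map (p i) ≫ f = F.map (p i) ≫ f') → f = f')
    (r : ∀ g, (A.ρ g).obj X ⟶ X) (hr : ∀ g i, (A.ρ g).map (p i) ≫ r g = (Y i).r g ≫ p i) :
    A.EquivariantObject :=
  ofMulOne X r
    (fun g h => hp (A.ρ h ⋙ A.ρ g) fun i => by
      rw [Functor.comp_map, reassoc_of% (A.ρ₂_naturality g h (p i)), hr,
        ← Functor.map_comp_assoc, hr, Functor.map_comp_assoc, hr, reassoc_of% (Y i).r_mul])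
    (hp (𝟭 C) fun i => by
      dsimp only [Functor.id_obj, Functor.id_map]
      rw [reassoc_of% (A.ρ₀_naturality (p i)), hr, reassoc_of% (Y i).r_one, Category.comp_id])

lemma comm_of_jointlyEpi {W X : A.EquivariantObject} (p : ∀ i, Y i ⟶ X)
    (hp : ∀ (F : C ⥤ C) [F.IsEquivalence] {Z : C} {f f' : F.obj X.obj ⟶ Z},
      (∀ i, F.map (p i).hom ≫ f = F.map (p i).hom ≫ f') → f = f')
    {f : X.obj ⟶ W.obj} (q : ∀ i, Y i ⟶ W) (hq : ∀ i, (p i).hom ≫ f = (q i).hom) (g : G) :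
    X.r g ≫ f = (A.ρ g).map f ≫ W.r g :=
  hp (A.ρ g) fun i => by
    rw [← reassoc_of% (p i).comm, hq, (q i).comm, ← Functor.map_comp_assoc, hq]

end JointlyEpi

section Limits

variable {J : Type*} [Category* J] {K : J ⥤ A.EquivariantObject}

/-- A limit cone of the underlying objects as a cone of equivariant objects. -/
def liftCone {c : Cone (K ⋙ forget A)} (hc : IsLimit c) : Cone K :=
  let s (g : G) : Cone (K ⋙ forget A) :=
    (Cone.postcompose (Functor.whiskerLeft K (rNatTrans A g))).obj ((A.ρ g).mapCone c)
  { pt := ofJointlyMono (Y := K.obj) c.π.app hc.hom_ext (fun g => hc.lift (s g))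
      fun g => hc.fac (s g)
    π :=
      { app := fun j => ⟨c.π.app j, fun g => hc.fac (s g) j⟩
        naturality := fun _ _ a => hom_ext (c.π.naturality a) } }

/-- `liftCone hc` is a limit cone. -/
def isLimitLiftCone {c : Cone (K ⋙ forget A)} (hc : IsLimit c) : IsLimit (liftCone hc) where
  lift s := ⟨hc.lift ((forget A).mapCone s),
    comm_of_jointlyMono (liftCone hc).π.app hc.hom_ext s.π.app (hc.fac ((forget A).mapCone s))⟩
  fac s j := hom_ext (hc.fac ((forget A).mapCone s) j)
  uniq s _ hm := hom_ext (hc.uniq ((forget A).mapCone s) _ fun j => congrArg Hom.hom (hm j))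

instance : CreatesLimitsOfShape J (forget A) where
  CreatesLimit := createsLimitOfReflectsIso fun c hc =>
    { liftedCone := liftCone hc
      validLift := Iso.refl c
      makesLimit := isLimitLiftCone hc }

/-- A colimit cocone of the underlying objects as a cocone of equivariant objects. -/
def liftCocone {c : Cocone (K ⋙ forget A)} (hc : IsColimit c) : Cocone K :=
  let s (g : G) : Cocone ((K ⋙ forget A) ⋙ A.ρ g) :=
    (Cocone.precompose (Functor.whiskerLeft K (rNatTrans A g))).obj c
  let hcρ (g : G) := isColimitOfPreserves (A.ρ g) hc
  { pt := ofJointlyEpi (Y := K.obj) c.ι.app (fun F => (isColimitOfPreserves F hc).hom_ext)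
      (fun g => (hcρ g).desc (s g)) fun g => (hcρ g).fac (s g)
    ι :=
      { app := fun j => ⟨c.ι.app j, fun g => ((hcρ g).fac (s g) j).symm⟩
        naturality := fun _ _ a => hom_ext (c.ι.naturality a) } }

/-- `liftCocone hc` is a colimit cocone. -/
def isColimitLiftCocone {c : Cocone (K ⋙ forget A)} (hc : IsColimit c) :
    IsColimit (liftCocone hc) where
  desc s := ⟨hc.desc ((forget A).mapCocone s),
    comm_of_jointlyEpi (liftCocone hc).ι.app (fun F => (isColimitOfPreserves F hc).hom_ext)
      s.ι.app (hc.fac ((forget A).mapCocone s))⟩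
  fac s j := hom_ext (hc.fac ((forget A).mapCocone s) j)
  uniq s _ hm := hom_ext (hc.uniq ((forget A).mapCocone s) _ fun j => congrArg Hom.hom (hm j))

instance : CreatesColimitsOfShape J (forget A) where
  CreatesColimit := createsColimitOfReflectsIso fun c hc =>
    { liftedCocone := liftCocone hc
      validLift := Iso.refl c
      makesColimit := isColimitLiftCocone hc }

end Limits

end EquivariantObject

end RightAction

namespace RightAction

variable {k : Type w} [Field k] {G : Type*} [Group G] {C : Type u} [Category.{v} C]
  [Preadditive C] [Linear k C] {A : RightAction k G C}

lemma tr_rfl (a : G) (X : C) : A.tr (Eq.refl a) X = 𝟙 _ := rfl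

lemma tr_comp_tr {a b c : G} (h : a = b) (h' : b = c) (X : C) :
    A.tr h X ≫ A.tr h' X = A.tr (h.trans h') X := by
  subst h h'
  rw [tr_rfl, Category.id_comp]

lemma tr_naturality {a b : G} (h : a = b) {X Y : C} (f : X ⟶ Y) :
    (A.ρ a).map f ≫ A.tr h Y = A.tr h X ≫ (A.ρ b).map f := by
  subst h
  rw [tr_rfl, tr_rfl, Category.id_comp, Category.comp_id]

namespace EquivariantObject

variable (X : A.EquivariantObject)

/-- The translate `ρ^g(U) → X` of a generalized element `U → X` of an equivariant object. -/
def act (g : G) {U : C} (f : U ⟶ X.obj) : (A.ρ g).obj U ⟶ X.obj := (A.ρ g).map f ≫ X.r g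

lemma act_id (g : G) : X.act g (𝟙 X.obj) = X.r g := by
  rw [act, CategoryTheory.Functor.map_id, Category.id_comp]

lemma act_comp (g : G) {U V : C} (e : U ⟶ V) (f : V ⟶ X.obj) :
    X.act g (e ≫ f) = (A.ρ g).map e ≫ X.act g f := by
  rw [act, act, Functor.map_comp, Category.assoc]

lemma act_act (g h : G) {U : C} (f : U ⟶ X.obj) :
    X.act g (X.act h f) = (A.ρ₂ g h).hom.app U ≫ X.act (h * g) f := by
  rw [act, act, Functor.map_comp, Category.assoc, X.r_mul, reassoc_of% (A.ρ₂_naturality g h f), act]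

lemma tr_act {a b : G} (h : a = b) {U : C} (f : U ⟶ X.obj) :
    A.tr h U ≫ X.act b f = X.act a f := by
  subst h
  rw [tr_rfl, Category.id_comp]

lemma act_one {U : C} (f : U ⟶ X.obj) : A.ρ₀.hom.app U ≫ X.act 1 f = f := by
  rw [act, ← reassoc_of% (A.ρ₀_naturality f), X.r_one, Category.comp_id]

lemma act_comp_hom (g : G) {Y : A.EquivariantObject} {U : C} (f : U ⟶ X.obj) (e : X ⟶ Y) :
    X.act g f ≫ e.hom = Y.act g (f ≫ e.hom) := by
  rw [act, act, Category.assoc, e.comm, Functor.map_comp, Category.assoc]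

lemma exists_act_eq (g : G) {U : C} (f : U ⟶ X.obj) :
    ∃ e : U ⟶ (A.ρ g).obj ((A.ρ g⁻¹).obj U), f = e ≫ X.act g (X.act g⁻¹ f) :=
  ⟨A.ρ₀.hom.app U ≫ A.tr (inv_mul_cancel g).symm U ≫ (A.ρ₂ g g⁻¹).inv.app U, by
    rw [act_act, Category.assoc, Category.assoc, Iso.inv_hom_id_app_assoc, tr_act, act_one]⟩

end EquivariantObject

end RightAction

section PairingEquiv

variable {C : Type u} [Category.{v} C] [MonoidalCategory C] (X Y : C) [ExactPairing X Y] (W : C)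

/-- Morphisms `W ⟶ Y` to a right dual `Y` of `X` correspond to pairings `W ⊗ X ⟶ 𝟙`. -/
def pairingEquiv : (W ⟶ Y) ≃ (W ⊗ X ⟶ 𝟙_ C) :=
  (λ_ Y).symm.homToEquiv.trans (tensorRightHomEquiv W X Y (𝟙_ C)).symm

variable {W}

lemma pairingEquiv_apply (f : W ⟶ Y) : pairingEquiv X Y W f = f ▷ X ≫ ε_ X Y := by
  change (f ≫ (λ_ Y).inv) ▷ X ≫ (α_ _ _ _).hom ≫ 𝟙_ C ◁ ε_ X Y ≫ (ρ_ (𝟙_ C)).hom = _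
  rw [← unitors_equal, leftUnitor_naturality, leftUnitor_tensor_hom_assoc, Iso.hom_inv_id_assoc,
    ← comp_whiskerRight_assoc, Category.assoc, Iso.inv_hom_id, Category.comp_id]

end PairingEquiv

namespace Grading.Decomposition

variable {Γ : Type*} [Group Γ] [Fintype Γ] {C : Type u} [Category.{v} C]
  [Preadditive C] [MonoidalCategory C] {𝒢 : Grading Γ C} {X Y : C} (D : 𝒢.Decomposition X)

lemma comp_π_comp_ι {s : Γ} {Z : C} (hZ : 𝒢.deg s Z) (f : Z ⟶ X) : (f ≫ D.π s) ≫ D.ι s = f := by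
  have h : ∑ t, (f ≫ D.π t) ≫ D.ι t = f := by
    simp only [Category.assoc, ← Preadditive.comp_sum, D.sum_π_ι, Category.comp_id]
  rwa [Finset.sum_eq_single_of_mem s (Finset.mem_univ s)] at h
  intro t _ ht
  rw [𝒢.hom_eq_zero hZ (D.mem t) ht.symm (f ≫ D.π t), zero_comp]

variable [MonoidalPreadditive C] (E : 𝒢.Decomposition Y)

lemma hom_ext_tensor (F : C ⥤ C) [F.Additive] {Z : C} {f g : F.obj (X ⊗ Y) ⟶ Z}
    (h : ∀ s t, F.map (D.ι s ⊗ₘ E.ι t) ≫ f = F.map (D.ι s ⊗ₘ E.ι t) ≫ g) : f = g := by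
  refine D.hom_ext (tensorRight Y ⋙ F) fun s => E.hom_ext (tensorLeft (D.comp s) ⋙ F) fun t => ?_
  have := h s t
  rw [MonoidalCategory.tensorHom_def', F.map_comp, Category.assoc, Category.assoc] at this
  exact this

lemma hom_ext_tensor_left {Z W : C} (F : 𝒢.Decomposition Z) {f g : (X ⊗ Y) ⊗ Z ⟶ W}
    (h : ∀ s t u, ((D.ι s ⊗ₘ E.ι t) ⊗ₘ F.ι u) ≫ f = ((D.ι s ⊗ₘ E.ι t) ⊗ₘ F.ι u) ≫ g) : f = g := by
  refine F.hom_ext (tensorLeft (X ⊗ Y)) fun u =>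
    D.hom_ext_tensor E (tensorRight (F.comp u)) fun s t => ?_
  have := h s t u
  rwa [MonoidalCategory.tensorHom_def, Category.assoc, Category.assoc] at this

lemma hom_ext_tensor_right {Z W : C} (F : 𝒢.Decomposition Z) {f g : X ⊗ Y ⊗ Z ⟶ W}
    (h : ∀ s t u, (D.ι s ⊗ₘ E.ι t ⊗ₘ F.ι u) ≫ f = (D.ι s ⊗ₘ E.ι t ⊗ₘ F.ι u) ≫ g) : f = g := by
  rw [← cancel_epi (α_ X Y Z).hom]
  refine D.hom_ext_tensor_left E F fun s t u => ?_
  rw [associator_naturality_assoc, associator_naturality_assoc, h]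

/-- The morphism from `X ⊗ Y` with given restrictions to the summands `X_s ⊗ Y_t`. -/
def tensorDesc {Z : C} (f : ∀ s t, D.comp s ⊗ E.comp t ⟶ Z) : X ⊗ Y ⟶ Z :=
  ∑ s, ∑ t, (D.π s ⊗ₘ E.π t) ≫ f s t

lemma ι_tensorDesc {Z : C} (f : ∀ s t, D.comp s ⊗ E.comp t ⟶ Z) (s t : Γ) :
    (D.ι s ⊗ₘ E.ι t) ≫ D.tensorDesc E f = f s t := by
  rw [tensorDesc, Preadditive.comp_sum, Finset.sum_eq_single_of_mem s (Finset.mem_univ s),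
    Preadditive.comp_sum, Finset.sum_eq_single_of_mem t (Finset.mem_univ t),
    tensorHom_comp_tensorHom_assoc, D.ι_π_self, E.ι_π_self, id_tensorHom_id, Category.id_comp]
  · intro v _ hv
    rw [tensorHom_comp_tensorHom_assoc, E.ι_π_ne t v hv.symm,
      MonoidalPreadditive.tensor_zero, zero_comp]
  · intro u _ hu
    simp only [Preadditive.comp_sum, tensorHom_comp_tensorHom_assoc, D.ι_π_ne s u hu.symm,
      MonoidalPreadditive.zero_tensor, zero_comp, Finset.sum_const_zero]

/-- `X ⊗ Y` is the coproduct of the objects `X_s ⊗ Y_t`. -/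
def isColimitTensor :
    IsColimit (Cofan.mk (X ⊗ Y) fun p : Γ × Γ => D.ι p.1 ⊗ₘ E.ι p.2) :=
  Cofan.IsColimit.mk _ (fun c => D.tensorDesc E fun s t => c.inj (s, t))
    (fun c p => D.ι_tensorDesc E (fun s t => c.inj (s, t)) p.1 p.2)
    fun c _ hm => D.hom_ext_tensor E (𝟭 C) fun s t =>
      (hm (s, t)).trans (D.ι_tensorDesc E (fun s t => c.inj (s, t)) s t).symm

end Grading.Decomposition

lemma isIso_of_isColimit_cofan {C : Type u} [Category.{v} C] {I J : Type*} {U : I → C} {V : J → C}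
    {X Y : C} {a : ∀ i, U i ⟶ X} {b : ∀ j, V j ⟶ Y} (ha : IsColimit (Cofan.mk X a))
    (hb : IsColimit (Cofan.mk Y b)) (σ : I ≃ J) (e : ∀ i, U i ≅ V (σ i)) {f : X ⟶ Y}
    (h : ∀ i, a i ≫ f = (e i).hom ≫ b (σ i)) : IsIso f := by
  let w : (Discrete.equivalence σ).functor ⋙ Discrete.functor V ≅ Discrete.functor U :=
    Discrete.natIso fun i => (e i.as).symm
  suffices f = (ha.coconePointsIsoOfEquivalence hb (Discrete.equivalence σ) w).hom by
    rw [this]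
    infer_instance
  refine ha.hom_ext fun i => (h i.as).trans ?_
  rw [IsColimit.coconePointsIsoOfEquivalence_hom]
  exact (ha.fac ((Cocone.equivalenceOfReindexing (Discrete.equivalence σ) w).functor.obj
    (Cofan.mk Y b)) i).symm.trans rfl

namespace MatchedPair

variable {G Γ : Type*} [Group G] [Group Γ] (P : MatchedPair G Γ)

lemma ract_injective (g : G) : Function.Injective fun s => P.ract s g :=
  Function.LeftInverse.injective (g := fun s => P.ract s g⁻¹) fun s => by
    dsimp only
    rw [← P.ract_mul, mul_inv_cancel, P.ract_one]

lemma exists_lact_eq_ract_eq (a : G) (t : Γ) : ∃ s g, P.lact s g = a ∧ P.ract s g = t := by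
  refine ⟨(P.ract t⁻¹ a⁻¹)⁻¹, P.lact (P.ract t⁻¹ a⁻¹)⁻¹⁻¹ a, P.lact_lact_inv _ _, ?_⟩
  rw [P.ract_lact_inv, inv_inv, ← P.ract_mul, inv_mul_cancel, P.ract_one, inv_inv]

end MatchedPair

namespace CrossedAction

variable {k : Type w} [Field k] {G Γ : Type*} [Group G] [Group Γ] [Fintype Γ]
  {P : MatchedPair G Γ} {C : Type u} [Category.{v} C] [Preadditive C] [Linear k C]
  [MonoidalCategory C] [MonoidalPreadditive C] [MonoidalLinear k C] [TensorCategory k C]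
  {A : CrossedAction k P C}

open RightAction RightAction.EquivariantObject

lemma tensor_act (X Y : A.Equivariantization) (g : G) {t : Γ} {U V : C} (hV : A.deg t V)
    (f : U ⟶ X.obj) (f' : V ⟶ Y.obj) :
    (X ⊗ Y).act g (f ⊗ₘ f') =
      (A.γ g U hV).hom ≫ (X.act (P.lact t g) f ⊗ₘ Y.act g f') := by
  change (A.ρ g).map _ ≫ tensorR X Y g = _
  rw [MonoidalCategory.tensorHom_def, Functor.map_comp, Category.assoc, map_tensorR X Y g hV,
    reassoc_of% (A.γ_natural_left g hV), ← tensorHom_id, tensorHom_comp_tensorHom,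
    Category.id_comp, act, act]

section rComp

variable (X : A.Equivariantization) (D : A.Decomposition X.obj) (g : G) (s : Γ)

lemma rComp_ι : rComp X D g s ≫ D.ι (P.ract s g) = X.act g (D.ι s) := by
  rw [← D.comp_π_comp_ι (A.map_mem g (D.mem s)) (X.act g (D.ι s)), act, rComp]
  simp only [Category.assoc]

lemma map_π_rComp :
    (A.ρ g).map (D.π s) ≫ rComp X D g s = X.r g ≫ D.π (P.ract s g) := by
  refine D.hom_ext (A.ρ g) fun u => ?_
  by_cases h : u = s
  · subst h
    rw [← Functor.map_comp_assoc, D.ι_π_self, CategoryTheory.Functor.map_id, Category.id_comp,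
      rComp]
  · rw [← Functor.map_comp_assoc, D.ι_π_ne u s h, Functor.map_zero, zero_comp,
      A.hom_eq_zero (A.map_mem g (D.mem u)) (D.mem _) (fun h' => h (P.ract_injective g h'))
        ((A.ρ g).map (D.ι u) ≫ X.r g ≫ D.π (P.ract s g))]

instance isIso_rComp : IsIso (rComp X D g s) := by
  refine ⟨D.ι (P.ract s g) ≫ inv (X.r g) ≫ (A.ρ g).map (D.π s), ?_, ?_⟩
  · rw [reassoc_of% (rComp_ι X D g s), act, Category.assoc, IsIso.hom_inv_id_assoc,
      ← Functor.map_comp, D.ι_π_self, CategoryTheory.Functor.map_id]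
  · rw [Category.assoc, Category.assoc, map_π_rComp, IsIso.inv_hom_id_assoc, D.ι_π_self]

end rComp

namespace CrossedBraiding

variable (B : A.CrossedBraiding)

/-- The braiding of `X` and `Y` as a morphism of `C`, defined by means of the chosen
decompositions; `tensorHom_braidingHom` shows that it does not depend on them. -/
def braidingHom (X Y : A.Equivariantization) : X.obj ⊗ Y.obj ⟶ Y.obj ⊗ X.obj :=
  (A.decomp X.obj).tensorDesc (A.decomp Y.obj) fun s t =>
    (B.c ((A.decomp X.obj).mem s) ((A.decomp Y.obj).mem t)).hom ≫
      (Y.act (B.lt s t) ((A.decomp Y.obj).ι t) ⊗ₘ X.act (B.ψ t) ((A.decomp X.obj).ι s))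

lemma tensorHom_braidingHom (X Y : A.Equivariantization) {s t : Γ} {U V : C}
    (hU : A.deg s U) (hV : A.deg t V) (f : U ⟶ X.obj) (f' : V ⟶ Y.obj) :
    (f ⊗ₘ f') ≫ B.braidingHom X Y =
      (B.c hU hV).hom ≫ (Y.act (B.lt s t) f' ⊗ₘ X.act (B.ψ t) f) := by
  rw [← (A.decomp X.obj).comp_π_comp_ι hU f, ← (A.decomp Y.obj).comp_π_comp_ι hV f',
    ← tensorHom_comp_tensorHom_assoc, braidingHom, Grading.Decomposition.ι_tensorDesc,
    reassoc_of% (B.c_natural hU _ hV _ _ _), tensorHom_comp_tensorHom, act_comp, act_comp]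

lemma ι_tensorHom_braidingHom (X Y : A.Equivariantization) (D : A.Decomposition X.obj)
    (E : A.Decomposition Y.obj) (s t : Γ) :
    (D.ι s ⊗ₘ E.ι t) ≫ B.braidingHom X Y = B.braidingComp X Y D E s t ≫
      (E.ι (P.ract t (B.lt s t)) ⊗ₘ D.ι (P.ract s (B.ψ t))) := by
  rw [B.tensorHom_braidingHom X Y (D.mem s) (E.mem t), braidingComp, Category.assoc,
    tensorHom_comp_tensorHom, rComp_ι, rComp_ι]

instance isIso_braidingComp (X Y : A.Equivariantization) (D : A.Decomposition X.obj)
    (E : A.Decomposition Y.obj) (s t : Γ) : IsIso (B.braidingComp X Y D E s t) := by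
  unfold braidingComp
  infer_instance

lemma braidingHom_naturality {X X' Y Y' : A.Equivariantization} (f : X ⟶ X') (f' : Y ⟶ Y') :
    (f ⊗ₘ f').hom ≫ B.braidingHom X' Y' = B.braidingHom X Y ≫ (f' ⊗ₘ f).hom := by
  refine (A.decomp X.obj).hom_ext_tensor (A.decomp Y.obj) (𝟭 C) fun s t => ?_
  have hs := (A.decomp X.obj).mem s
  have ht := (A.decomp Y.obj).mem t
  rw [Functor.id_map, tensorHom_hom, tensorHom_hom, tensorHom_comp_tensorHom_assoc,
    B.tensorHom_braidingHom X' Y' hs ht, reassoc_of% (B.tensorHom_braidingHom X Y hs ht),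
    tensorHom_comp_tensorHom, act_comp_hom, act_comp_hom]

lemma braidingHom_equivariant (X Y : A.Equivariantization) (g : G) :
    (X ⊗ Y).r g ≫ B.braidingHom X Y = (A.ρ g).map (B.braidingHom X Y) ≫ (Y ⊗ X).r g := by
  refine (A.decomp X.obj).hom_ext_tensor (A.decomp Y.obj) (A.ρ g) fun s t => ?_
  have hs := (A.decomp X.obj).mem s
  have ht := (A.decomp Y.obj).mem t
  set d := (A.decomp X.obj).ι s
  set e := (A.decomp Y.obj).ι t
  suffices (X ⊗ Y).act g (d ⊗ₘ e) ≫ B.braidingHom X Y =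
      (Y ⊗ X).act g ((d ⊗ₘ e) ≫ B.braidingHom X Y) by
    rwa [act, act, Functor.map_comp, Category.assoc, Category.assoc] at this
  rw [tensor_act X Y g ht, Category.assoc,
    B.tensorHom_braidingHom X Y (A.map_mem _ hs) (A.map_mem g ht),
    B.tensorHom_braidingHom X Y hs ht, act_comp, tensor_act Y X g (A.map_mem (B.ψ t) hs)]
  simp only [act_act, ← tensorHom_comp_tensorHom]
  rw [← reassoc_of% (B.c_equivariant g hs ht)]
  simp only [tensorHom_comp_tensorHom, tr_act]

lemma tensorHom_braidingHom_tensor_right (X Y Z : A.Equivariantization) {s t u : Γ} {U V W : C}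
    (hU : A.deg s U) (hV : A.deg t V) (hW : A.deg u W) (f : U ⟶ X.obj) (f' : V ⟶ Y.obj)
    (f'' : W ⟶ Z.obj) :
    (f ⊗ₘ f' ⊗ₘ f'') ≫ B.braidingHom X (Y ⊗ Z) ≫ (α_ Y.obj Z.obj X.obj).hom =
      (B.c hU (A.tensor_mem hV hW)).hom ≫ (A.γ (B.lt s (t * u)) V hW).hom ▷ _ ≫
        (α_ _ _ _).hom ≫ (Y.act (P.lact u (B.lt s (t * u))) f' ⊗ₘ
          Z.act (B.lt s (t * u)) f'' ⊗ₘ X.act (B.ψ (t * u)) f) := by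
  have h := B.tensorHom_braidingHom X (Y ⊗ Z) hU (A.tensor_mem hV hW) f (f' ⊗ₘ f'')
  rw [reassoc_of% h, tensor_act Y Z _ hW, ← associator_naturality, ← tensorHom_id,
    tensorHom_comp_tensorHom_assoc, Category.id_comp]

lemma tensorHom_braidingHom_tensor_left (X Y Z : A.Equivariantization) {s t u : Γ} {U V W : C}
    (hU : A.deg s U) (hV : A.deg t V) (hW : A.deg u W) (f : U ⟶ X.obj) (f' : V ⟶ Y.obj)
    (f'' : W ⟶ Z.obj) :
    ((f ⊗ₘ f') ⊗ₘ f'') ≫ B.braidingHom (X ⊗ Y) Z =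
      (B.c (A.tensor_mem hU hV) hW).hom ≫ _ ◁ (A.γ (B.ψ u) U hV).hom ≫
        (Z.act (B.lt (s * t) u) f'' ⊗ₘ X.act (P.lact t (B.ψ u)) f ⊗ₘ Y.act (B.ψ u) f') := by
  have h := B.tensorHom_braidingHom (X ⊗ Y) Z (A.tensor_mem hU hV) hW (f ⊗ₘ f') f''
  rw [h, tensor_act X Y _ hV, ← id_tensorHom, tensorHom_comp_tensorHom, Category.id_comp]

lemma tensorHom_whiskerRight_braidingHom (X Y Z : A.Equivariantization) {s t : Γ} {U V W : C}
    (hU : A.deg s U) (hV : A.deg t V) (f : U ⟶ X.obj) (f' : V ⟶ Y.obj) (f'' : W ⟶ Z.obj) :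
    ((f ⊗ₘ f') ⊗ₘ f'') ≫ B.braidingHom X Y ▷ Z.obj =
      (B.c hU hV).hom ▷ W ≫ ((Y.act (B.lt s t) f' ⊗ₘ X.act (B.ψ t) f) ⊗ₘ f'') := by
  rw [← tensorHom_id, ← tensorHom_id, tensorHom_comp_tensorHom, tensorHom_comp_tensorHom,
    B.tensorHom_braidingHom X Y hU hV, Category.comp_id, Category.id_comp]

lemma tensorHom_whiskerLeft_braidingHom (X Y Z : A.Equivariantization) {t u : Γ} {U V W : C}
    (hV : A.deg t V) (hW : A.deg u W) (f : U ⟶ X.obj) (f' : V ⟶ Y.obj) (f'' : W ⟶ Z.obj) :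
    (f ⊗ₘ f' ⊗ₘ f'') ≫ X.obj ◁ B.braidingHom Y Z =
      U ◁ (B.c hV hW).hom ≫ (f ⊗ₘ Z.act (B.lt t u) f'' ⊗ₘ Y.act (B.ψ u) f') := by
  rw [← id_tensorHom, ← id_tensorHom, tensorHom_comp_tensorHom, tensorHom_comp_tensorHom,
    B.tensorHom_braidingHom Y Z hV hW, Category.comp_id, Category.id_comp]

lemma hexagon_forward (X Y Z : A.Equivariantization) :
    (α_ X.obj Y.obj Z.obj).hom ≫ B.braidingHom X (Y ⊗ Z) ≫ (α_ Y.obj Z.obj X.obj).hom =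
      B.braidingHom X Y ▷ Z.obj ≫ (α_ Y.obj X.obj Z.obj).hom ≫ Y.obj ◁ B.braidingHom X Z := by
  refine (A.decomp X.obj).hom_ext_tensor_left (A.decomp Y.obj) (A.decomp Z.obj) fun s t u => ?_
  have hs := (A.decomp X.obj).mem s
  have ht := (A.decomp Y.obj).mem t
  have hu := (A.decomp Z.obj).mem u
  set d := (A.decomp X.obj).ι s
  set e := (A.decomp Y.obj).ι t
  set f := (A.decomp Z.obj).ι u
  rw [associator_naturality_assoc,
    B.tensorHom_braidingHom_tensor_right X Y Z hs ht hu,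
    reassoc_of% (B.tensorHom_whiskerRight_braidingHom X Y Z hs ht), associator_naturality_assoc,
    B.tensorHom_whiskerLeft_braidingHom Y X Z (A.map_mem _ hs) hu, act_act]
  have h := B.c_tensor_right hs ht hu =≫ (Y.act (P.lact u (B.lt s (t * u))) e ⊗ₘ
    Z.act (B.lt s (t * u)) f ⊗ₘ X.act (B.ψ (t * u)) d)
  simpa only [Category.assoc, tensorHom_comp_tensorHom, tr_act] using h

lemma hexagon_reverse (X Y Z : A.Equivariantization) :
    (α_ X.obj Y.obj Z.obj).inv ≫ B.braidingHom (X ⊗ Y) Z ≫ (α_ Z.obj X.obj Y.obj).inv =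
      X.obj ◁ B.braidingHom Y Z ≫ (α_ X.obj Z.obj Y.obj).inv ≫ B.braidingHom X Z ▷ Y.obj := by
  refine (A.decomp X.obj).hom_ext_tensor_right (A.decomp Y.obj) (A.decomp Z.obj) fun s t u => ?_
  have hs := (A.decomp X.obj).mem s
  have ht := (A.decomp Y.obj).mem t
  have hu := (A.decomp Z.obj).mem u
  set d := (A.decomp X.obj).ι s
  set e := (A.decomp Y.obj).ι t
  set f := (A.decomp Z.obj).ι u
  rw [associator_inv_naturality_assoc,
    reassoc_of% (B.tensorHom_braidingHom_tensor_left X Y Z hs ht hu),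
    reassoc_of% (B.tensorHom_whiskerLeft_braidingHom X Y Z ht hu), associator_inv_naturality_assoc,
    B.tensorHom_whiskerRight_braidingHom X Z Y hs (A.map_mem _ hu), act_act,
    ← cancel_mono (α_ Z.obj X.obj Y.obj).hom]
  have h := B.c_tensor_left hs ht hu =≫ (Z.act (B.lt (s * t) u) f ⊗ₘ
    X.act (P.lact t (B.ψ u)) d ⊗ₘ Y.act (B.ψ u) e)
  simpa only [Category.assoc, tensorHom_comp_tensorHom, tensorHom_comp_tensorHom_assoc,
    ← tensorHom_id, ← associator_naturality, tr_act, Iso.inv_hom_id, Category.comp_id,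
    Category.id_comp] using h

/-- The permutation `(s, t) ↦ (t ◁ (t⁻¹ ▷ φ(s⁻¹)), s ◁ ψ(t))` of the pairs of degrees that the
braiding induces. -/
def degreeEquiv : Γ × Γ ≃ Γ × Γ :=
  Equiv.ofBijective (fun p => (P.ract p.2 (B.lt p.1 p.2), P.ract p.1 (B.ψ p.2))) <|
    Finite.injective_iff_bijective.1 <| by
      rintro ⟨s, t⟩ ⟨s', t'⟩ h
      obtain ⟨h₁, h₂⟩ := Prod.ext_iff.1 h
      dsimp only at h₁ h₂
      have e : B.lt s t = B.lt s' t' := by rw [← inv_inj, B.lact_φ, B.lact_φ, h₂]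
      rw [e] at h₁
      obtain rfl : t = t' := P.ract_injective _ h₁
      rw [P.ract_injective _ h₂]

instance isIso_braidingHom (X Y : A.Equivariantization) : IsIso (B.braidingHom X Y) :=
  let D := A.decomp X.obj
  let E := A.decomp Y.obj
  isIso_of_isColimit_cofan (D.isColimitTensor E) (E.isColimitTensor D) B.degreeEquiv
    (fun p => (asIso (B.braidingComp X Y D E p.1 p.2) :))
    fun p => B.ι_tensorHom_braidingHom X Y D E p.1 p.2

/-- The category `C^{(G, Γ)}` is braided. -/
abbrev braidedCategory : BraidedCategory A.Equivariantization where
  braiding X Y := mkIso (asIso (B.braidingHom X Y)) (B.braidingHom_equivariant X Y)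
  braiding_naturality_right X _ _ f := hom_ext <| by
    have h := B.braidingHom_naturality (𝟙 X) f
    rw [id_tensorHom, tensorHom_id] at h
    exact h
  braiding_naturality_left f Z := hom_ext <| by
    have h := B.braidingHom_naturality f (𝟙 Z)
    rw [id_tensorHom, tensorHom_id] at h
    exact h
  hexagon_forward X Y Z := hom_ext (B.hexagon_forward X Y Z)
  hexagon_reverse X Y Z := hom_ext (B.hexagon_reverse X Y Z)

end CrossedBraiding

section ActPairing

/-- The translate `ρ^{t ▷ g}(U) ⊗ ρ^g(V) → T` of a pairing `U ⊗ V → T` with values in an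
equivariant object, where `V ∈ C_t`. -/
def actPairing (T : A.Equivariantization) (g : G) {t : Γ} {U V : C} (hV : A.deg t V)
    (p : U ⊗ V ⟶ T.obj) : (A.ρ (P.lact t g)).obj U ⊗ (A.ρ g).obj V ⟶ T.obj :=
  (A.γ g U hV).inv ≫ T.act g p

variable (T : A.Equivariantization)

lemma actPairing_naturality (g : G) {t : Γ} {U U' V V' : C} (hV : A.deg t V) (hV' : A.deg t V')
    (f : U ⟶ U') (f' : V ⟶ V') (p : U' ⊗ V' ⟶ T.obj) :
    ((A.ρ (P.lact t g)).map f ⊗ₘ (A.ρ g).map f') ≫ actPairing T g hV' p =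
      actPairing T g hV ((f ⊗ₘ f') ≫ p) := by
  rw [actPairing, actPairing, act_comp, Iso.eq_inv_comp,
    ← reassoc_of% (A.γ_natural g hV hV' f f'), Iso.hom_inv_id_assoc]

lemma actPairing_mul (g h : G) {t : Γ} {U V : C} (hV : A.deg t V) (p : U ⊗ V ⟶ T.obj) :
    ((A.ρ₂ (P.lact (P.ract t h) g) (P.lact t h)).hom.app U ⊗ₘ (A.ρ₂ g h).hom.app V) ≫
        A.tr (P.lact_mul t h g).symm U ▷ _ ≫ actPairing T (h * g) hV p =
      actPairing T g (A.map_mem h hV) (actPairing T h hV p) := by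
  rw [actPairing, actPairing, actPairing, act_comp, act_act, Iso.eq_inv_comp,
    ← cancel_epi ((A.ρ g).map (A.γ h U hV).hom), ← reassoc_of% (A.γ_mul g h U hV),
    ← comp_whiskerRight_assoc, tr_comp_tr, tr_rfl, id_whiskerRight, Category.id_comp,
    Iso.hom_inv_id_assoc, ← Functor.map_comp_assoc, Iso.hom_inv_id,
    CategoryTheory.Functor.map_id, Category.id_comp]

lemma actPairing_one {t : Γ} {U V : C} (hV : A.deg t V) (p : U ⊗ V ⟶ T.obj) :
    (A.ρ₀.hom.app U ⊗ₘ A.ρ₀.hom.app V) ≫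
      A.tr (P.lact_one t).symm U ▷ _ ≫ actPairing T 1 hV p = p := by
  rw [← A.γ_one U hV, Category.assoc, Category.assoc, ← comp_whiskerRight_assoc, tr_comp_tr,
    tr_rfl, id_whiskerRight, Category.id_comp, actPairing, Iso.hom_inv_id_assoc, act_one]

lemma act_tensorHom_act_comp_hom {X Y : A.Equivariantization} (m : X ⊗ Y ⟶ T) (g : G) {t : Γ}
    {U V : C} (hV : A.deg t V) (f : U ⟶ X.obj) (f' : V ⟶ Y.obj) :
    (X.act (P.lact t g) f ⊗ₘ Y.act g f') ≫ m.hom = actPairing T g hV ((f ⊗ₘ f') ≫ m.hom) := by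
  rw [actPairing, Iso.eq_inv_comp, ← reassoc_of% (tensor_act X Y g hV), act_comp_hom]

end ActPairing

lemma hom_ext_act (X : A.Equivariantization) (a : G) {W Z : C} {F F' : W ⊗ X.obj ⟶ Z}
    (h : ∀ (s : Γ) (g : G) (U : C), A.deg s U → P.lact s g = a → ∀ f : U ⟶ X.obj,
      W ◁ X.act g f ≫ F = W ◁ X.act g f ≫ F') : F = F' := by
  refine (A.decomp X.obj).hom_ext (tensorLeft W) fun t => ?_
  obtain ⟨s, g, rfl, rfl⟩ := P.exists_lact_eq_ract_eq a t
  obtain ⟨e, he⟩ := X.exists_act_eq g ((A.decomp X.obj).ι (P.ract s g))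
  have hU := A.map_mem g⁻¹ ((A.decomp X.obj).mem (P.ract s g))
  rw [← P.ract_mul, mul_inv_cancel, P.ract_one] at hU
  change _ ◁ _ ≫ F = _ ◁ _ ≫ F'
  rw [he, MonoidalCategory.whiskerLeft_comp, Category.assoc, Category.assoc,
    h s g _ hU rfl]

section Dual

variable (X : A.Equivariantization) (Y : C) [ExactPairing X.obj Y]

/-- The pairing `ρ^a(Y) ⊗ X → 𝟙` that defines the action on the dual `Y` of `X`. It is given on the
images of the `ρ^a(Y) ⊗ ρ^g(X_s)` under `id ⊗ r^g`, where `s ▷ g = a`, by the translate by `g` of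
the evaluation `ε : Y ⊗ X → 𝟙`. -/
def dualPairing (a : G) : (A.ρ a).obj Y ⊗ X.obj ⟶ 𝟙_ C :=
  ∑ s : Γ, (A.tr (P.lact_lact_inv s a).symm Y ⊗ₘ
      inv (X.r (P.lact s⁻¹ a)) ≫ (A.ρ (P.lact s⁻¹ a)).map ((A.decomp X.obj).π s)) ≫
    actPairing (𝟙_ _) (P.lact s⁻¹ a) ((A.decomp X.obj).mem s)
      (Y ◁ (A.decomp X.obj).ι s ≫ ε_ X.obj Y)

lemma act_ι_dualPairing (a : G) (s : Γ) :
    _ ◁ X.act (P.lact s⁻¹ a) ((A.decomp X.obj).ι s) ≫ dualPairing X Y a =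
      A.tr (P.lact_lact_inv s a).symm Y ▷ _ ≫ actPairing (𝟙_ _) (P.lact s⁻¹ a)
        ((A.decomp X.obj).mem s) (Y ◁ (A.decomp X.obj).ι s ≫ ε_ X.obj Y) := by
  set D := A.decomp X.obj
  rw [dualPairing, Preadditive.comp_sum, Finset.sum_eq_single_of_mem s (Finset.mem_univ s)]
  · rw [← id_tensorHom, tensorHom_comp_tensorHom_assoc, Category.id_comp, act, Category.assoc,
      IsIso.hom_inv_id_assoc, ← Functor.map_comp, D.ι_π_self, CategoryTheory.Functor.map_id,
      tensorHom_id]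
  · intro t _ ht
    have hdeg : P.ract s (P.lact s⁻¹ a) ≠ P.ract t (P.lact t⁻¹ a) := by
      rw [P.ract_lact_inv, P.ract_lact_inv, ne_eq, inv_inj]
      exact fun h => ht (inv_injective (P.ract_injective a h)).symm
    rw [← id_tensorHom, tensorHom_comp_tensorHom_assoc,
      A.hom_eq_zero (A.map_mem _ (D.mem s)) (A.map_mem _ (D.mem t)) hdeg (X.act _ _ ≫ _),
      MonoidalPreadditive.tensor_zero, zero_comp]

/-- The action on the dual `Y` of `X`. -/
def dualR (a : G) : (A.ρ a).obj Y ⟶ Y := (pairingEquiv X.obj Y _).symm (dualPairing X Y a)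

lemma dualR_evaluation (a : G) : dualR X Y a ▷ X.obj ≫ ε_ X.obj Y = dualPairing X Y a := by
  rw [← pairingEquiv_apply, dualR, Equiv.apply_symm_apply]

lemma tensorHom_act_evaluation (a g : G) {s : Γ} (ha : P.lact s g = a) {U : C} (hU : A.deg s U)
    {W : C} (h : W ⟶ Y) (f : U ⟶ X.obj) :
    ((A.ρ a).map h ≫ dualR X Y a ⊗ₘ X.act g f) ≫ ε_ X.obj Y =
      A.tr ha.symm W ▷ _ ≫ actPairing (𝟙_ _) g hU ((h ⊗ₘ f) ≫ ε_ X.obj Y) := by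
  obtain rfl : g = P.lact s⁻¹ a := by rw [← ha, P.lact_inv_lact]
  set D := A.decomp X.obj
  calc
    _ = ((A.ρ a).map h ⊗ₘ (A.ρ (P.lact s⁻¹ a)).map (f ≫ D.π s)) ≫
          _ ◁ X.act (P.lact s⁻¹ a) (D.ι s) ≫ dualPairing X Y a := by
      rw [← dualR_evaluation, ← MonoidalCategory.tensorHom_def'_assoc,
        tensorHom_comp_tensorHom_assoc, ← act_comp, D.comp_π_comp_ι hU]
    _ = A.tr ha.symm W ▷ _ ≫
          ((A.ρ _).map h ⊗ₘ (A.ρ _).map (f ≫ D.π s)) ≫ actPairing (𝟙_ _) (P.lact s⁻¹ a)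
            (D.mem s) (Y ◁ D.ι s ≫ ε_ X.obj Y) := by
      rw [act_ι_dualPairing, ← tensorHom_id, ← tensorHom_id, tensorHom_comp_tensorHom_assoc,
        tensorHom_comp_tensorHom_assoc, tr_naturality, Category.id_comp, Category.comp_id]
    _ = _ := by
      rw [actPairing_naturality _ _ hU, ← id_tensorHom, tensorHom_comp_tensorHom_assoc,
        D.comp_π_comp_ι hU, Category.comp_id]

lemma dualR_mul (b a : G) :
    (A.ρ b).map (dualR X Y a) ≫ dualR X Y b = (A.ρ₂ b a).hom.app Y ≫ dualR X Y (a * b) := by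
  refine (pairingEquiv X.obj Y _).injective <| hom_ext_act X (a * b) fun s c U hU hc f => ?_
  obtain ⟨h, rfl⟩ : ∃ h, P.lact s h = a := ⟨_, P.lact_lact_inv s a⟩
  obtain ⟨g, rfl⟩ : ∃ g, P.lact (P.ract s h) g = b := ⟨_, P.lact_lact_inv _ b⟩
  obtain rfl : c = h * g := by
    rw [← P.lact_inv_lact s c, hc, ← P.lact_mul, P.lact_inv_lact]
  rw [pairingEquiv_apply, pairingEquiv_apply, ← MonoidalCategory.tensorHom_def'_assoc,
    ← MonoidalCategory.tensorHom_def'_assoc, ← cancel_epi (_ ◁ (A.ρ₂ g h).hom.app U)]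
  calc
    _ = ((A.ρ _).map (dualR X Y _) ≫ dualR X Y _ ⊗ₘ X.act g (X.act h f)) ≫ ε_ X.obj Y := by
      rw [act_act, ← id_tensorHom, tensorHom_comp_tensorHom_assoc, Category.id_comp]
    _ = actPairing (𝟙_ _) g (A.map_mem h hU)
          (((A.ρ _).map (𝟙 Y) ≫ dualR X Y _ ⊗ₘ X.act h f) ≫ ε_ X.obj Y) := by
      rw [tensorHom_act_evaluation X Y _ g rfl (A.map_mem h hU), tr_rfl, id_whiskerRight,
        Category.id_comp, CategoryTheory.Functor.map_id, Category.id_comp]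
    _ = actPairing (𝟙_ _) g (A.map_mem h hU)
          (actPairing (𝟙_ _) h hU ((𝟙 Y ⊗ₘ f) ≫ ε_ X.obj Y)) := by
      rw [tensorHom_act_evaluation X Y _ h rfl hU, tr_rfl, id_whiskerRight, Category.id_comp]
    _ = ((A.ρ₂ _ _).hom.app Y ⊗ₘ (A.ρ₂ g h).hom.app U) ≫
          ((A.ρ _).map (𝟙 Y) ≫ dualR X Y _ ⊗ₘ X.act (h * g) f) ≫ ε_ X.obj Y := by
      rw [← actPairing_mul, tensorHom_act_evaluation X Y _ (h * g) hc hU]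
    _ = _ := by
      rw [tensorHom_comp_tensorHom_assoc, ← id_tensorHom, tensorHom_comp_tensorHom_assoc,
        Category.id_comp, CategoryTheory.Functor.map_id, Category.id_comp]

lemma dualR_one : A.ρ₀.hom.app Y ≫ dualR X Y 1 = 𝟙 Y := by
  refine (pairingEquiv X.obj Y _).injective <|
    (A.decomp X.obj).hom_ext (tensorLeft Y) fun s => ?_
  set D := A.decomp X.obj
  rw [pairingEquiv_apply, pairingEquiv_apply]
  calc
    _ = (A.ρ₀.hom.app Y ⊗ₘ A.ρ₀.hom.app (D.comp s)) ≫
          ((A.ρ 1).map (𝟙 Y) ≫ dualR X Y 1 ⊗ₘ X.act 1 (D.ι s)) ≫ ε_ X.obj Y := by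
      rw [tensorHom_comp_tensorHom_assoc, act_one, CategoryTheory.Functor.map_id,
        Category.id_comp, MonoidalCategory.tensorHom_def', Category.assoc]
      rfl
    _ = (𝟙 Y ⊗ₘ D.ι s) ≫ ε_ X.obj Y := by
      rw [tensorHom_act_evaluation X Y 1 1 (P.lact_one s) (D.mem s), actPairing_one]
    _ = _ := by
      dsimp only [Functor.id_obj, tensorLeft]
      rw [id_tensorHom, id_whiskerRight, Category.id_comp]
      rfl

/-- The dual of `X` in `C^{(G, Γ)}`. -/
abbrev dual : A.Equivariantization where
  obj := Y
  r := dualR X Y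
  isIso_r := A.isIso_of_mul_one _ (dualR_mul X Y) (dualR_one X Y)
  r_mul := dualR_mul X Y
  r_one := dualR_one X Y

/-- The evaluation as a morphism of `C^{(G, Γ)}`. -/
def dualEvaluation : dual X Y ⊗ X ⟶ 𝟙_ A.Equivariantization where
  hom := ε_ X.obj Y
  comm g := (A.decomp X.obj).hom_ext (tensorLeft Y ⋙ A.ρ g) fun s => by
    set D := A.decomp X.obj
    calc
      _ = (dual X Y ⊗ X).act g (𝟙 Y ⊗ₘ D.ι s) ≫ ε_ X.obj Y := by
        rw [act, id_tensorHom, Category.assoc]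
        rfl
      _ = (𝟙_ A.Equivariantization).act g ((𝟙 Y ⊗ₘ D.ι s) ≫ ε_ X.obj Y) := by
        rw [reassoc_of% (tensor_act (dual X Y) X g (D.mem s)), act,
          tensorHom_act_evaluation X Y _ g rfl (D.mem s), tr_rfl, id_whiskerRight,
          Category.id_comp, actPairing, Iso.hom_inv_id_assoc]
      _ = _ := by
        rw [act, Functor.map_comp, Category.assoc, id_tensorHom]
        rfl

/-- The coevaluation as a morphism of `C^{(G, Γ)}`. -/
def dualCoevaluation : 𝟙_ A.Equivariantization ⟶ X ⊗ dual X Y where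
  hom := η_ X.obj Y
  comm g := by
    let m : (X ⊗ dual X Y) ⊗ X ⟶ X := (α_ _ _ _).hom ≫ X ◁ dualEvaluation X Y ≫ (ρ_ X).hom
    have hm : η_ X.obj Y ▷ X.obj ≫ m.hom = (λ_ X).hom.hom := by
      change η_ X.obj Y ▷ X.obj ≫ (α_ _ _ _).hom ≫ X.obj ◁ ε_ X.obj Y ≫ (ρ_ X.obj).hom =
        (λ_ X.obj).hom
      rw [ExactPairing.evaluation_coevaluation_assoc, Iso.inv_hom_id, Category.comp_id]
    refine (tensorRightHomEquiv _ X.obj Y _).symm.injective ?_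
    change (_ ▷ X.obj) ≫ m.hom = (_ ▷ X.obj) ≫ m.hom
    refine hom_ext_act X g fun s h U hU hg f => ?_
    subst hg
    calc
      _ = ((𝟙_ A.Equivariantization).act (P.lact s h) (𝟙 (𝟙_ C)) ⊗ₘ X.act h f) ≫
            (λ_ X).hom.hom := by
        rw [← hm, comp_whiskerRight_assoc, MonoidalCategory.tensorHom_def'_assoc]
        exact congrArg (fun r => _ ◁ _ ≫ r ▷ _ ≫ _) (act_id _ _).symm
      _ = actPairing X h hU ((𝟙 (𝟙_ C) ⊗ₘ f) ≫ (λ_ X).hom.hom) :=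
        act_tensorHom_act_comp_hom X _ h hU _ f
      _ = actPairing X h hU ((η_ X.obj Y ⊗ₘ f) ≫ m.hom) := by
        rw [← hm, id_tensorHom, MonoidalCategory.tensorHom_def'_assoc]
      _ = ((X ⊗ dual X Y).act (P.lact s h) (η_ X.obj Y) ⊗ₘ X.act h f) ≫ m.hom :=
        (act_tensorHom_act_comp_hom X m h hU _ f).symm
      _ = _ := by
        rw [MonoidalCategory.tensorHom_def'_assoc]
        rfl

instance exactPairingDual : ExactPairing X (dual X Y) where
  coevaluation' := dualCoevaluation X Y
  evaluation' := dualEvaluation X Y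
  coevaluation_evaluation' := hom_ext (ExactPairing.coevaluation_evaluation X.obj Y)
  evaluation_coevaluation' := hom_ext (ExactPairing.evaluation_coevaluation X.obj Y)

end Dual

/-- The category `C^{(G, Γ)}` has right duals. -/
abbrev rightRigidCategory [RightRigidCategory C] : RightRigidCategory A.Equivariantization where
  rightDual X := ⟨dual X (HasRightDual.rightDual X.obj)⟩

lemma tensorCategory [RigidCategory A.Equivariantization] :
    TensorCategory k A.Equivariantization := by
  let : Abelian C := TensorCategory.abelian k C
  have : HasFiniteLimits A.Equivariantization := ⟨fun J _ _ =>
    hasLimitsOfShape_of_hasLimitsOfShape_createsLimitsOfShape (forget A.toRightAction)⟩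
  have : HasFiniteColimits A.Equivariantization := ⟨fun J _ _ =>
    hasColimitsOfShape_of_hasColimitsOfShape_createsColimitsOfShape (forget A.toRightAction)⟩
  have : PreservesFiniteLimits (forget A.toRightAction) := ⟨fun J _ _ => inferInstance⟩
  have : PreservesFiniteColimits (forget A.toRightAction) := ⟨fun J _ _ => inferInstance⟩
  exact TensorCategory.of_exact_conservative k (forget A.toRightAction) (Iso.refl _)

end CrossedAction

end

theorem theorem7p4_general {k : Type w} [Field k] {G Γ : Type*} [Group G]
    [Group Γ] [Fintype Γ] {P : MatchedPair G Γ} {C : Type u} [Category.{v} C] [Preadditive C]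
    [Linear k C] [MonoidalCategory C] [MonoidalPreadditive C] [MonoidalLinear k C]
    [TensorCategory k C] (A : CrossedAction k P C) (B : A.CrossedBraiding) :
    TensorCategory k A.Equivariantization ∧
      ∃ σ : BraidedCategory A.Equivariantization,
        ∀ (X Y : A.Equivariantization) (D : A.Decomposition X.obj) (E : A.Decomposition Y.obj)
          (s t : Γ),
          IsIso (B.braidingComp X Y D E s t) ∧
            (D.ι s ⊗ₘ E.ι t) ≫ (σ.braiding X Y).hom.hom =
              B.braidingComp X Y D E s t ≫
                (E.ι (P.ract t (P.lact t⁻¹ (B.φ s⁻¹))) ⊗ₘ D.ι (P.ract s (B.ψ t))) := by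
  obtain ⟨_⟩ := TensorCategory.rigid (C := C) k
  let : BraidedCategory A.Equivariantization := B.braidedCategory
  let : RightRigidCategory A.Equivariantization := CrossedAction.rightRigidCategory
  let : RigidCategory A.Equivariantization := BraidedCategory.rigidCategoryOfRightRigidCategory
  exact ⟨CrossedAction.tensorCategory, B.braidedCategory, fun X Y D E s t =>
    ⟨inferInstance, B.ι_tensorHom_braidingHom X Y D E s t⟩⟩

theorem theorem7p4 {k : Type w} [Field k] [IsAlgClosed k] {G Γ : Type*} [Group G] [Finite G]
    [Group Γ] [Fintype Γ] {P : MatchedPair G Γ} {C : Type u} [Category.{v} C] [Preadditive C]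
    [Linear k C] [MonoidalCategory C] [MonoidalPreadditive C] [MonoidalLinear k C]
    [TensorCategory k C] (A : CrossedAction k P C) (B : A.CrossedBraiding) :
    TensorCategory k A.Equivariantization ∧
      ∃ σ : BraidedCategory A.Equivariantization,
        ∀ (X Y : A.Equivariantization) (D : A.Decomposition X.obj) (E : A.Decomposition Y.obj)
          (s t : Γ),
          IsIso (B.braidingComp X Y D E s t) ∧
            (D.ι s ⊗ₘ E.ι t) ≫ (σ.braiding X Y).hom.hom =
              B.braidingComp X Y D E s t ≫
                (E.ι (P.ract t (P.lact t⁻¹ (B.φ s⁻¹))) ⊗ₘ D.ι (P.ract s (B.ψ t))) :=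
  theorem7p4_general A B
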